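/- **Setting.** Let $n,m\ge 1$, $x_0\in\mathbb{C}^n$ with $\|x_0\|=1$, and $\gamma>0$; put $\sigma=1/\gamma^2$. Let $a_i^1,a_i^2$ ($1\le i\le m$) be random vectors in $\mathbb{C}^n$ with law $\mathcal N(0,\tfrac12 I_n)+i\,\mathcal N(0,\tfrac12 I_n)$ and let $\nu_i^1,\nu_i^2$ ($1\le i\le m$) be exponential random variables with rate $\gamma$ (mean $1/\gamma$, variance $\sigma$), all $4m$ of them mutually independent. The one-bit measurements of $x_0$ under additive exponential noise $\theta(z)=z+\nu$ are $$y_i=\operatorname{sign}\Big(\big(|\langle a_i^1,x_0\rangle|^2+\nu_i^1\big)-\big(|\langle a_i^2,x_0\rangle|^2+\nu_i^2\big)\Big),\qquad 1\le i\le m,$$ and $\hat x_m$ denotes any solution of the maximum eigenvalue problem $$\max_{\|x\|=1} x^*\hat C_m x,\qquad \hat C_m=\frac1m\sum_{i=1}^m y_i\big(a_i^1a_i^{1,*}-a_i^2a_i^{2,*}\big).$$ **Corollary (One-bit recovery under exponential noise).** There are absolute constants $C,K>0$ such that for every $\gamma>0$, with $\sigma=1/\gamma^2$, there is an $N=N(\sigma)$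 for which the following holds. Let $n\ge1$, $x_0\in\mathbb{C}^n$ with $\|x_0\|=1$, and $0<\varepsilon\le 1$, and suppose that $n\ge N$ or $\varepsilon\le \frac{1+2\sqrt\sigma}{(1+\sqrt\sigma)^2}$. If $$m\ \ge\ \frac{C}{\varepsilon^2}\,\frac{(1+\sqrt\sigma)^2}{1+2\sqrt\sigma}\;n\log n ,$$ then with probability at least $1-K n^{-2}$ every solution $\hat x_m$ satisfies $$\|\hat x_m-e^{i\phi}x_0\|^2\le\varepsilon\qquad\text{for some global phase }\phi\in[0,2\pi].$$ In particular, for each fixed noise level $\sigma$, the probability of recovery is $1-O(n^{-2})$ as $n\to\infty$, uniformly in $x_0$, $\varepsilon\in(0,1]$ and all such $m$. -/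

import Mathlib

open MeasureTheory ProbabilityTheory
open scoped Matrix

noncomputable section

namespace OneBit

/-- The law `𝒩(0, ½ Iₙ) + i 𝒩(0, ½ Iₙ)` on `ℂⁿ`: the law of `u + i v`, where `u` and `v` are
independent real Gaussian vectors whose coordinates are independent, centered and of
variance `1/2`. -/
def complexGaussian (n : ℕ) : Measure (EuclideanSpace ℂ (Fin n)) :=
  ((Measure.pi fun _ : Fin n => gaussianReal 0 (1 / 2)).prod
      (Measure.pi fun _ : Fin n => gaussianReal 0 (1 / 2))).map
    fun p => WithLp.toLp 2 fun k => (p.1 k : ℂ) + (p.2 k : ℂ) * Complex.I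

/-- The randomness of the noisy model: `m` pairs of sensing vectors `a i 0`, `a i 1`, each with a
noise variable `ν i 0`, `ν i 1`. Every sensing vector is standard complex Gaussian, every noise
variable is exponential with rate `γ` (mean `1/γ`, variance `1/γ²`), and all these `4m` variables
are mutually independent: the `2m` pairs (sensing vector, noise) are mutually independent, and
within each pair the sensing vector and the noise are independent. -/
structure IsNoisyModel {Ω : Type*} [MeasurableSpace Ω] (P : Measure Ω) {n m : ℕ} (γ : ℝ)
    (a : Fin m → Fin 2 → Ω → EuclideanSpace ℂ (Fin n)) (ν : Fin m → Fin 2 → Ω → ℝ) : Prop where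
  law_sensing : ∀ i j, HasLaw (a i j) (complexGaussian n) P
  law_noise : ∀ i j, HasLaw (ν i j) (expMeasure γ) P
  indep_within : ∀ i j, IndepFun (a i j) (ν i j) P
  indep_pairs : iIndepFun (fun (q : Fin m × Fin 2) ω => (a q.1 q.2 ω, ν q.1 q.2 ω)) P

/-- The noisy phaseless measurement `θ(|⟨a, x₀⟩|²)` with `θ(z) = z + ν`. -/
def noisyIntensity {n : ℕ} (x₀ a : EuclideanSpace ℂ (Fin n)) (ν : ℝ) : ℝ :=
  ‖inner ℂ a x₀‖ ^ 2 + ν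

/-- The one-bit measurement `y = sign (θ(|⟨a¹, x₀⟩|²) - θ(|⟨a², x₀⟩|²))` of a pair of sensing
vectors. (`Real.sign 0 = 0`; in the noisy model a tie has probability zero.) -/
def oneBit {n : ℕ} (x₀ : EuclideanSpace ℂ (Fin n)) (a : Fin 2 → EuclideanSpace ℂ (Fin n))
    (ν : Fin 2 → ℝ) : ℝ :=
  Real.sign (noisyIntensity x₀ (a 0) (ν 0) - noisyIntensity x₀ (a 1) (ν 1))

/-- The rank one matrix `a a*`. -/
def outer {n : ℕ} (a : EuclideanSpace ℂ (Fin n)) : Matrix (Fin n) (Fin n) ℂ :=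
  Matrix.vecMulVec a.ofLp (star a.ofLp)

/-- The matrix `Ĉₘ = (1/m) ∑ᵢ yᵢ (aᵢ¹ aᵢ¹* - aᵢ² aᵢ²*)`. -/
def empMatrix {n m : ℕ} (y : Fin m → ℝ) (a : Fin m → Fin 2 → EuclideanSpace ℂ (Fin n)) :
    Matrix (Fin n) (Fin n) ℂ :=
  (1 / (m : ℂ)) • ∑ i, (y i : ℂ) • (outer (a i 0) - outer (a i 1))

/-- The quadratic form `x* M x` (real for Hermitian `M`). -/
def quadForm {n : ℕ} (M : Matrix (Fin n) (Fin n) ℂ) (x : EuclideanSpace ℂ (Fin n)) : ℝ :=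
  (star x.ofLp ⬝ᵥ (M *ᵥ x.ofLp)).re

/-- `x` solves the 1BitPhase problem: maximize `x* Ĉₘ x` subject to `‖x‖ = 1`. -/
def IsOneBitPhaseSolution {n m : ℕ} (y : Fin m → ℝ)
    (a : Fin m → Fin 2 → EuclideanSpace ℂ (Fin n)) (x : EuclideanSpace ℂ (Fin n)) : Prop :=
  ‖x‖ = 1 ∧ ∀ z : EuclideanSpace ℂ (Fin n), ‖z‖ = 1 →
    quadForm (empMatrix y a) z ≤ quadForm (empMatrix y a) x

end OneBit

end

/-! The mean of the quadratic form of `Ĉₘ` on the unit sphere is `l |⟨x₀, ·⟩|²`, where `l` is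
`signal γ x₀`. Indeed a bit depends on the sensing vectors only through `⟨a, x₀⟩`; the components
orthogonal to `x₀` are independent of it and contribute equally for both vectors of a pair, so they
cancel (`integral_bit_mul_gap`). The noise only damps `l`: averaging the sign over the noise leaves
at least `1 - exp(-γ|d|)` of a gap `d`, whence `l ≥ 1 / (10 (1 + √σ))` (`signal_ge`).

Each summand is sub-exponential, so at a fixed unit vector the form deviates from its mean by `τ`
with probability at most `2 exp(-m τ² / 1024)`. A `1/2`-net with `25ⁿ` points extends this to the
whole sphere (`exists_good_event`).

In `solution_close` the maximizer `x`, with `x₀` rotated to the best phase, satisfies `l ‖x - x₀‖² /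
2 ≤ D x - D x₀`, where `D` is the deviation. As `D` is a Hermitian form bounded by `M` on the
sphere, the right side is of order `M ‖x - x₀‖`, not merely `M`; this gives `‖x - x₀‖² ≤ 16 M² /
l²`. So `M` of order `l √ε` suffices, that is, `m` of order `n / (l² ε)`.

With `λ = (1 + 2√σ) / (1 + √σ)²`, which is comparable to `l`, the hypothesis on `m` makes the
exponent of the tail at least `6 n (λ log n / ε)`. It beats the net and leaves `n⁻²` when `λ / ε ≥
1`, or when `n` is so large that `λ log n ≥ 1`: these are the two alternatives assumed. -/

noncomputable section

namespace OneBit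

/-! ### Hermitian forms on the sphere and nets. -/

/-- A continuous real-valued function on `ℂⁿ` that behaves like a Hermitian quadratic form. -/
structure IsHermitianForm {n : ℕ} (q : EuclideanSpace ℂ (Fin n) → ℝ) : Prop where
  continuous : Continuous q
  smul : ∀ (c : ℂ) z, q (c • z) = ‖c‖ ^ 2 * q z
  -- For `q z = z* M z` the mixed terms have the same coefficient `-2αβ` in both values and cancel.
  -- This substitutes for polarization without a sesquilinear form.
  cross : ∀ (α β : ℝ) x y, q ((α : ℂ) • x - (β : ℂ) • y) - q ((β : ℂ) • x - (α : ℂ) • y) =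
    (α ^ 2 - β ^ 2) * (q x - q y)

lemma isHermitianForm_norm_inner_sq {n : ℕ} (a : EuclideanSpace ℂ (Fin n)) :
    IsHermitianForm fun z => ‖inner ℂ a z‖ ^ 2 where
  continuous := by fun_prop
  smul c z := by rw [inner_smul_right, norm_mul, mul_pow]
  cross α β x y := by
    simp only [inner_sub_right, inner_smul_right, ← Complex.normSq_eq_norm_sq,
      Complex.normSq_apply, Complex.sub_re, Complex.sub_im, Complex.mul_re, Complex.mul_im,
      Complex.ofReal_re, Complex.ofReal_im]
    ring

lemma IsHermitianForm.const_mul {n : ℕ} {q : EuclideanSpace ℂ (Fin n) → ℝ}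
    (hq : IsHermitianForm q) (c : ℝ) : IsHermitianForm fun z => c * q z where
  continuous := hq.continuous.const_mul c
  smul d z := by rw [hq.smul]; ring
  cross α β x y := by rw [← mul_sub, hq.cross]; ring

lemma IsHermitianForm.sub {n : ℕ} {q r : EuclideanSpace ℂ (Fin n) → ℝ}
    (hq : IsHermitianForm q) (hr : IsHermitianForm r) : IsHermitianForm fun z => q z - r z where
  continuous := hq.continuous.sub hr.continuous
  smul d z := by rw [hq.smul, hr.smul]; ring
  cross α β x y := by linear_combination hq.cross α β x y - hr.cross α β x y

lemma isHermitianForm_sum {n : ℕ} {ι : Type*} (s : Finset ι)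
    {q : ι → EuclideanSpace ℂ (Fin n) → ℝ} (hq : ∀ i, IsHermitianForm (q i)) :
    IsHermitianForm fun z => ∑ i ∈ s, q i z where
  continuous := continuous_finsetSum _ fun i _ => (hq i).continuous
  smul d z := by simp_rw [(hq _).smul, Finset.mul_sum]
  cross α β x y := by
    simp_rw [← Finset.sum_sub_distrib, Finset.mul_sum, (hq _).cross]

lemma IsHermitianForm.abs_le_mul_norm_sq {n : ℕ} {q : EuclideanSpace ℂ (Fin n) → ℝ}
    (hq : IsHermitianForm q) {M : ℝ} (hM : ∀ x, ‖x‖ = 1 → |q x| ≤ M)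
    (z : EuclideanSpace ℂ (Fin n)) : |q z| ≤ M * ‖z‖ ^ 2 := by
  rcases eq_or_ne z 0 with rfl | hz
  · have := hq.smul 0 0
    simp only [smul_zero, norm_zero, ne_eq, OfNat.ofNat_ne_zero, not_false_eq_true, zero_pow,
      zero_mul] at this
    simp [this]
  · have hz' : ‖z‖ ≠ 0 := norm_ne_zero_iff.2 hz
    have h1 : ‖((‖z‖⁻¹ : ℝ) : ℂ) • z‖ = 1 := by
      rw [norm_smul, Complex.norm_real, norm_inv, norm_norm, inv_mul_cancel₀ hz']
    have h2 := hM _ h1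
    rw [hq.smul, Complex.norm_real, norm_inv, norm_norm, abs_mul, abs_of_nonneg (by positivity),
      inv_pow, inv_mul_le_iff₀ (by positivity)] at h2
    linarith

lemma norm_smul_sub_smul_sq {n : ℕ} {x y : EuclideanSpace ℂ (Fin n)} (hx : ‖x‖ = 1)
    (hy : ‖y‖ = 1) (α β : ℝ) :
    ‖(α : ℂ) • x - (β : ℂ) • y‖ ^ 2 = (α - β) ^ 2 + α * β * ‖x - y‖ ^ 2 := by
  rw [@norm_sub_sq ℂ, @norm_sub_sq ℂ, inner_smul_left, inner_smul_right, norm_smul, norm_smul, hx,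
    hy, Complex.norm_real, Complex.norm_real, mul_pow, mul_pow, Real.norm_eq_abs, Real.norm_eq_abs,
    sq_abs, sq_abs]
  simp only [Complex.conj_ofReal, RCLike.re_to_complex, Complex.re_ofReal_mul]
  ring

/-- A difference of values of a form is controlled by the distance of the points. -/
lemma IsHermitianForm.sub_le {n : ℕ} {q : EuclideanSpace ℂ (Fin n) → ℝ}
    (hq : IsHermitianForm q) {M : ℝ} (hM : ∀ x, ‖x‖ = 1 → |q x| ≤ M)
    {x y : EuclideanSpace ℂ (Fin n)} (hx : ‖x‖ = 1) (hy : ‖y‖ = 1) {t : ℝ} (ht : t ≠ 0) :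
    q x - q y ≤ M * (t ^ 2 * ‖x - y‖ ^ 2 + (4 - ‖x - y‖ ^ 2) / t ^ 2) / 2 := by
  -- With these coefficients `α² - β² = 4` and `αβ = t² - 1/t²`: as `t` grows the difference of the
  -- coefficients shrinks while the weight of `‖x - y‖²` grows. The choice `t² = 2 / ‖x - y‖` would
  -- give a bound linear in the distance.
  have h1 := hq.cross (t + 1 / t) (t - 1 / t) x y
  have h2 : (t + 1 / t) ^ 2 - (t - 1 / t) ^ 2 = 4 := by field_simp; ring
  rw [h2] at h1
  have h3 := hq.abs_le_mul_norm_sq hM (((t + 1 / t : ℝ) : ℂ) • x - ((t - 1 / t : ℝ) : ℂ) • y)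
  have h4 := hq.abs_le_mul_norm_sq hM (((t - 1 / t : ℝ) : ℂ) • x - ((t + 1 / t : ℝ) : ℂ) • y)
  rw [norm_smul_sub_smul_sq hx hy] at h3 h4
  have h5 : (t + 1 / t) * (t - 1 / t) = t ^ 2 - 1 / t ^ 2 := by field_simp; ring
  have h6 : (t + 1 / t - (t - 1 / t)) ^ 2 = 4 / t ^ 2 := by field_simp; ring
  have h7 : (t - 1 / t - (t + 1 / t)) ^ 2 = 4 / t ^ 2 := by field_simp; ring
  rw [h5, h6] at h3
  rw [mul_comm (t - 1 / t), h5, h7] at h4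
  have h8 := (abs_le.1 h3).2
  have h9 := (abs_le.1 h4).1
  have h10 : M * (t ^ 2 * ‖x - y‖ ^ 2 + (4 - ‖x - y‖ ^ 2) / t ^ 2) =
    M * (4 / t ^ 2 + (t ^ 2 - 1 / t ^ 2) * ‖x - y‖ ^ 2) := by ring
  rw [h10]
  linarith

/-- The unit sphere of `ℂⁿ` has a `1/2`-net with at most `25ⁿ` elements. -/
lemma exists_half_net (n : ℕ) : ∃ s : Finset (EuclideanSpace ℂ (Fin n)),
    (∀ c ∈ s, ‖c‖ = 1) ∧ s.card ≤ 25 ^ n ∧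
      ∀ x : EuclideanSpace ℂ (Fin n), ‖x‖ = 1 → ∃ c ∈ s, ‖x - c‖ ≤ 1 / 2 := by
  classical
  let S : Set (Finset (EuclideanSpace ℂ (Fin n))) :=
    {s | (∀ c ∈ s, ‖c‖ = 1) ∧ ∀ c ∈ s, ∀ d ∈ s, c ≠ d → 1 / 2 ≤ ‖c - d‖}
  have hcard : ∀ s ∈ S, s.card ≤ 25 ^ n := by
    intro s hs
    have hinj : Function.Injective fun c : EuclideanSpace ℂ (Fin n) => (2 : ℂ) • c :=
      smul_right_injective _ two_ne_zero
    -- Doubling turns `1/2`-separated unit vectors into `1`-separated vectors of norm `2`. There are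
    -- at most `5 ^ dim` of these, and the real dimension is `2n`.
    have := Besicovitch.card_le_of_separated (s.image fun c => (2 : ℂ) • c) ?_ ?_
    · rw [Finset.card_image_of_injective _ hinj] at this
      refine this.trans_eq ?_
      have : Module.finrank ℝ (EuclideanSpace ℂ (Fin n)) = 2 * n := by
        rw [← Module.finrank_mul_finrank ℝ ℂ, Complex.finrank_real_complex,
          finrank_euclideanSpace_fin]
      rw [this, pow_mul]; norm_num
    · simp only [Finset.mem_image, forall_exists_index, and_imp]
      rintro _ c hc rfl
      rw [norm_smul, hs.1 c hc]; simp
    · simp only [Finset.mem_image, forall_exists_index, and_imp]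
      rintro _ c hc rfl _ d hd rfl hcd
      have := hs.2 c hc d hd fun h => hcd (by rw [h])
      rw [← smul_sub, norm_smul, Complex.norm_ofNat]
      linarith
  have hne : S.Nonempty := ⟨∅, by simp [S]⟩
  -- A separated set of maximal cardinality is a net, since a point far from it could be added.
  obtain ⟨s, hs, hmin⟩ :=
    (measure fun s : Finset (EuclideanSpace ℂ (Fin n)) => 25 ^ n - s.card).wf.has_min S hne
  refine ⟨s, hs.1, hcard s hs, fun x hx => ?_⟩
  by_contra! hfar
  have hxs : x ∉ s := fun h => by
    have := hfar x h
    rw [sub_self, norm_zero] at this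
    norm_num at this
  have hins : insert x s ∈ S := by
    refine ⟨?_, ?_⟩
    · intro c hc
      rcases Finset.mem_insert.1 hc with rfl | hc
      exacts [hx, hs.1 c hc]
    · intro c hc d hd hcd
      rcases Finset.mem_insert.1 hc with h1 | h1 <;> rcases Finset.mem_insert.1 hd with h2 | h2
      · exact absurd (h1.trans h2.symm) hcd
      · rw [h1]; exact (hfar d h2).le
      · rw [h2, norm_sub_rev]; exact (hfar c h1).le
      · exact hs.2 c h1 d h2 hcd
  have h1 := hcard _ hins
  refine hmin _ hins ?_
  change 25 ^ n - (insert x s).card < 25 ^ n - s.card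
  rw [Finset.card_insert_of_notMem hxs] at h1 ⊢
  omega

/-- A form that is small on a `1/2`-net of the sphere is small on the sphere. -/
lemma IsHermitianForm.abs_le_of_net {n : ℕ} {q : EuclideanSpace ℂ (Fin n) → ℝ}
    (hq : IsHermitianForm q) {s : Finset (EuclideanSpace ℂ (Fin n))} (hs : ∀ c ∈ s, ‖c‖ = 1)
    (hnet : ∀ x : EuclideanSpace ℂ (Fin n), ‖x‖ = 1 → ∃ c ∈ s, ‖x - c‖ ≤ 1 / 2)
    {τ : ℝ} (hτ : ∀ c ∈ s, |q c| ≤ τ) {x : EuclideanSpace ℂ (Fin n)} (hx : ‖x‖ = 1) :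
    |q x| ≤ 32 * τ := by
  obtain ⟨z, hz, hmax⟩ := (isCompact_sphere (0 : EuclideanSpace ℂ (Fin n)) 1).exists_isMaxOn
    ⟨x, by simpa using hx⟩ hq.continuous.abs.continuousOn
  have hz1 : ‖z‖ = 1 := by simpa using hz
  have hM : ∀ y : EuclideanSpace ℂ (Fin n), ‖y‖ = 1 → |q y| ≤ |q z| :=
    fun y hy => hmax (by simpa using hy)
  obtain ⟨c, hc, hzc⟩ := hnet z hz1
  have hd : ‖z - c‖ ^ 2 ≤ 1 / 4 := by
    have := pow_le_pow_left₀ (norm_nonneg (z - c)) hzc 2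
    norm_num at this ⊢; exact this
  have h0 := abs_nonneg (q z)
  -- At distance at most `1/2`, `t = 2` gives a factor `31/32 < 1`, so the maximum of `|q|` can be
  -- absorbed, at the price of the constant `32`.
  have h1 := hq.sub_le hM hz1 (hs c hc) (two_ne_zero (α := ℝ))
  have h2 := hq.sub_le hM (hs c hc) hz1 (two_ne_zero (α := ℝ))
  rw [norm_sub_rev] at h2
  have h3 : |q z| * (2 ^ 2 * ‖z - c‖ ^ 2 + (4 - ‖z - c‖ ^ 2) / 2 ^ 2) / 2 ≤ 31 / 32 * |q z| := by
    have : (2 ^ 2 * ‖z - c‖ ^ 2 + (4 - ‖z - c‖ ^ 2) / 2 ^ 2) ≤ 31 / 16 := by linarith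
    have := mul_le_mul_of_nonneg_left this h0
    linarith
  have h4 : |q z| - |q c| ≤ 31 / 32 * |q z| :=
    (abs_sub_abs_le_abs_sub _ _).trans (abs_le.2 ⟨by linarith, by linarith⟩)
  have := hτ c hc
  have := hM x hx
  linarith

/-! ### From a small deviation to a nearby maximizer. -/

/-- The deviation of the quadratic form of `Ĉₘ` from `l |⟨x₀, ·⟩|²`. -/
def deviation {n m : ℕ} (y : Fin m → ℝ) (a : Fin m → Fin 2 → EuclideanSpace ℂ (Fin n)) (l : ℝ)
    (x₀ z : EuclideanSpace ℂ (Fin n)) : ℝ :=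
  1 / m * ∑ i, y i * (‖inner ℂ (a i 0) z‖ ^ 2 - ‖inner ℂ (a i 1) z‖ ^ 2) -
    l * ‖inner ℂ x₀ z‖ ^ 2

lemma isHermitianForm_deviation {n m : ℕ} (y : Fin m → ℝ)
    (a : Fin m → Fin 2 → EuclideanSpace ℂ (Fin n)) (l : ℝ) (x₀ : EuclideanSpace ℂ (Fin n)) :
    IsHermitianForm (deviation y a l x₀) :=
  ((isHermitianForm_sum _ fun i => ((isHermitianForm_norm_inner_sq (a i 0)).sub
    (isHermitianForm_norm_inner_sq (a i 1))).const_mul (y i)).const_mul _).sub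
    ((isHermitianForm_norm_inner_sq x₀).const_mul l)

lemma quadForm_outer {n : ℕ} (a z : EuclideanSpace ℂ (Fin n)) :
    star z.ofLp ⬝ᵥ (outer a *ᵥ z.ofLp) = ((‖inner ℂ a z‖ ^ 2 : ℝ) : ℂ) := by
  have h1 : inner ℂ a z = star a.ofLp ⬝ᵥ z.ofLp := by
    rw [EuclideanSpace.inner_eq_star_dotProduct, dotProduct_comm]
  have h2 : inner ℂ z a = star z.ofLp ⬝ᵥ a.ofLp := by
    rw [EuclideanSpace.inner_eq_star_dotProduct, dotProduct_comm]
  rw [outer, Matrix.vecMulVec_mulVec, dotProduct_smul, ← h1, ← h2, MulOpposite.smul_eq_mul_unop,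
    MulOpposite.unop_op, ← inner_conj_symm z a, mul_comm, Complex.mul_conj, Complex.normSq_eq_norm_sq]

lemma quadForm_empMatrix {n m : ℕ} (y : Fin m → ℝ)
    (a : Fin m → Fin 2 → EuclideanSpace ℂ (Fin n)) (z : EuclideanSpace ℂ (Fin n)) :
    quadForm (empMatrix y a) z =
      1 / m * ∑ i, y i * (‖inner ℂ (a i 0) z‖ ^ 2 - ‖inner ℂ (a i 1) z‖ ^ 2) := by
  have : star z.ofLp ⬝ᵥ (empMatrix y a *ᵥ z.ofLp) = ((1 / m * ∑ i, y i *
      (‖inner ℂ (a i 0) z‖ ^ 2 - ‖inner ℂ (a i 1) z‖ ^ 2) : ℝ) : ℂ) := by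
    rw [empMatrix, Matrix.smul_mulVec, dotProduct_smul, Matrix.sum_mulVec, dotProduct_sum]
    simp_rw [Matrix.smul_mulVec, dotProduct_smul, Matrix.sub_mulVec, dotProduct_sub,
      quadForm_outer]
    push_cast
    simp [smul_eq_mul]
  rw [quadForm, this, Complex.ofReal_re]

/-- Some phase of `x₀` makes the inner product with `x` a nonnegative real. -/
lemma exists_phase {n : ℕ} (x₀ x : EuclideanSpace ℂ (Fin n)) :
    ∃ φ : ℝ, 0 ≤ φ ∧ φ ≤ 2 * Real.pi ∧
      inner ℂ (Complex.exp (Complex.I * φ) • x₀) x = (‖inner ℂ x₀ x‖ : ℂ) := by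
  set w := inner ℂ x₀ x with hw
  have key : ∀ φ : ℝ, ∀ k : ℤ, φ = Complex.arg w + k * (2 * Real.pi) →
      inner ℂ (Complex.exp (Complex.I * φ) • x₀) x = (‖w‖ : ℂ) := by
    intro φ k hφ
    have he : Complex.exp (Complex.I * φ) = Complex.exp (Complex.arg w * Complex.I) := by
      rw [Complex.exp_eq_exp_iff_exists_int]
      exact ⟨k, by rw [hφ]; push_cast; ring⟩
    rw [inner_smul_left, he, ← hw]
    nth_rw 2 [← Complex.norm_mul_exp_arg_mul_I w]
    rw [← Complex.exp_conj, mul_left_comm, ← Complex.exp_add]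
    simp
  rcases le_or_gt 0 (Complex.arg w) with h | h
  · exact ⟨Complex.arg w, h, by linarith [Complex.arg_le_pi w, Real.pi_pos],
      key _ 0 (by simp)⟩
  · exact ⟨Complex.arg w + 2 * Real.pi, by linarith [Complex.neg_pi_lt_arg w, Real.pi_pos],
      by linarith, key _ 1 (by simp)⟩

/-- If the deviation is small on the sphere, every solution is close to `x₀` up to a phase. -/
lemma solution_close {n m : ℕ} {y : Fin m → ℝ} {a : Fin m → Fin 2 → EuclideanSpace ℂ (Fin n)}
    {l M : ℝ} (hl : 0 < l) (hM0 : 0 < M) {x₀ x : EuclideanSpace ℂ (Fin n)} (hx₀ : ‖x₀‖ = 1)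
    (hM : ∀ z, ‖z‖ = 1 → |deviation y a l x₀ z| ≤ M) (hx : IsOneBitPhaseSolution y a x) :
    ∃ φ : ℝ, 0 ≤ φ ∧ φ ≤ 2 * Real.pi ∧
      ‖x - Complex.exp (Complex.I * φ) • x₀‖ ^ 2 ≤ 16 * M ^ 2 / l ^ 2 := by
  obtain ⟨φ, h0, h1, hφ⟩ := exists_phase x₀ x
  refine ⟨φ, h0, h1, ?_⟩
  obtain ⟨hx1, hmax⟩ := hx
  set e := Complex.exp (Complex.I * φ) with he
  have hen : ‖e‖ = 1 := by rw [he, mul_comm, Complex.norm_exp_ofReal_mul_I]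
  have hex : ‖e • x₀‖ = 1 := by rw [norm_smul, hen, hx₀, one_mul]
  set c := ‖inner ℂ x₀ x‖ with hc
  have hc1 : c ≤ 1 := by simpa [hx1, hx₀] using norm_inner_le_norm (𝕜 := ℂ) x₀ x
  have hc0 : 0 ≤ c := norm_nonneg _
  have hδ : ‖x - e • x₀‖ ^ 2 = 2 - 2 * c := by
    rw [@norm_sub_sq ℂ, ← inner_conj_symm, hφ, hx1, hex]
    simp; ring
  set δ := ‖x - e • x₀‖ ^ 2 with hδd
  have hq := isHermitianForm_deviation y a l x₀
  have hmx := hmax (e • x₀) hex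
  have hdx : deviation y a l x₀ x = quadForm (empMatrix y a) x - l * c ^ 2 := by
    rw [quadForm_empMatrix, deviation, hc]
  have hdx0 : deviation y a l x₀ (e • x₀) = quadForm (empMatrix y a) (e • x₀) - l := by
    rw [quadForm_empMatrix, deviation, inner_smul_right, norm_mul, hen, inner_self_eq_norm_sq_to_K,
      hx₀]
    simp
  -- Optimality of `x` leaves `l (1 - c²)`, which is at least `l (1 - c) = l δ / 2`.
  have hlow : l * δ / 2 ≤ deviation y a l x₀ x - deviation y a l x₀ (e • x₀) := by
    rw [hdx, hdx0, hδ]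
    have : l * (2 - 2 * c) / 2 ≤ l - l * c ^ 2 := by
      nlinarith [mul_nonneg (mul_nonneg hl.le hc0) (sub_nonneg.2 hc1)]
    linarith
  -- This `t` makes the term proportional to `δ` in the upper bound equal to `l δ / 4`, half of the
  -- lower bound.
  set t := √(l / (2 * M)) with ht
  have htp : 0 < t := Real.sqrt_pos.2 (by positivity)
  have ht2 : t ^ 2 = l / (2 * M) := Real.sq_sqrt (by positivity)
  have hup := hq.sub_le hM hx1 hex htp.ne'
  rw [ht2, ← hδd] at hup
  have h5 : M * (l / (2 * M) * δ + (4 - δ) / (l / (2 * M))) / 2 =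
      l * δ / 4 + (4 - δ) * M ^ 2 / l := by field_simp; ring
  have h6 : (4 - δ) * M ^ 2 / l ≤ 4 * M ^ 2 / l := by
    have : 0 ≤ δ := sq_nonneg _
    gcongr; linarith
  have h7 : l * δ / 4 ≤ 4 * M ^ 2 / l := by linarith
  rw [le_div_iff₀ (by positivity)]
  rw [le_div_iff₀ hl] at h7
  nlinarith

/-! ### Complex Gaussian vectors: characteristic functions, independence, moments. -/

/-- The standard complex Gaussian law on `ℂ`, given by its density. -/
def gaussianC : Measure ℂ :=
  volume.withDensity fun z => ENNReal.ofReal (Real.pi⁻¹ * Real.exp (-‖z‖ ^ 2))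

lemma integral_gaussianC {E : Type*} [NormedAddCommGroup E] [NormedSpace ℝ E] (f : ℂ → E) :
    ∫ z, f z ∂gaussianC = ∫ z, (Real.pi⁻¹ * Real.exp (-‖z‖ ^ 2)) • f z := by
  rw [gaussianC, integral_withDensity_eq_integral_toReal_smul (by fun_prop) (by simp)]
  refine integral_congr_ae (.of_forall fun z => ?_)
  simp only
  rw [ENNReal.toReal_ofReal (by positivity)]

lemma integral_pow_mul_exp_complex (k : ℕ) {b : ℝ} (hb : 0 < b) :
    ∫ z : ℂ, ‖z‖ ^ (2 * k) * Real.exp (-b * ‖z‖ ^ 2) =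
      Real.pi * (b ^ (k + 1))⁻¹ * k.factorial := by
  have := Complex.integral_rpow_mul_exp_neg_mul_rpow (p := 2) (q := (2 * k : ℕ)) (b := b)
    (by norm_num) (lt_of_lt_of_le (by norm_num) (Nat.cast_nonneg _)) hb
  simp only [Real.rpow_natCast, Real.rpow_two] at this
  rw [this]
  have h1 : (((2 * k : ℕ) : ℝ) + 2) / 2 = k + 1 := by push_cast; ring
  have h2 : -(((2 * k : ℕ) : ℝ) + 2) / 2 = -((k + 1 : ℕ) : ℝ) := by push_cast; ring
  rw [h1, h2, Real.Gamma_nat_eq_factorial, Real.rpow_neg hb.le, Real.rpow_natCast]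
  ring

/-- The squared modulus is exponentially distributed with rate `1`, hence the factorials. -/
lemma integral_pow_gaussianC (k : ℕ) : ∫ z, ‖z‖ ^ (2 * k) ∂gaussianC = k.factorial := by
  rw [integral_gaussianC]
  have := integral_pow_mul_exp_complex k one_pos
  simp_rw [smul_eq_mul, mul_assoc, integral_const_mul]
  simp_rw [mul_comm (Real.exp _)]
  simp only [neg_mul, one_mul, one_pow, inv_one, mul_one] at this
  rw [this]
  field_simp

lemma integrable_pow_gaussianC (k : ℕ) : Integrable (fun z => ‖z‖ ^ (2 * k)) gaussianC := by
  -- The Bochner integral of a non-integrable function is `0` by convention, so a nonzero value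
  -- proves integrability.
  refine .of_integral_ne_zero ?_
  rw [integral_pow_gaussianC]
  positivity

lemma integral_exp_gaussianC : ∫ z, Real.exp (‖z‖ ^ 2 / 2) ∂gaussianC = 2 := by
  rw [integral_gaussianC]
  have := integral_pow_mul_exp_complex 0 (b := 1 / 2) (by norm_num)
  simp_rw [smul_eq_mul, mul_assoc, integral_const_mul, ← Real.exp_add]
  simp only [mul_zero, pow_zero, one_mul, zero_add, pow_one, Nat.factorial_zero, Nat.cast_one,
    mul_one] at this
  have h : ∀ z : ℂ, -‖z‖ ^ 2 + ‖z‖ ^ 2 / 2 = -(1 / 2) * ‖z‖ ^ 2 := fun z => by ring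
  simp_rw [h, this]
  field_simp

instance : IsProbabilityMeasure gaussianC := by
  have h1 : Integrable (fun _ : ℂ => (1 : ℝ)) gaussianC := by
    simpa using integrable_pow_gaussianC 0
  have : IsFiniteMeasure gaussianC :=
    (integrable_const_iff_isFiniteMeasure one_ne_zero).1 h1
  have h2 : gaussianC.real Set.univ = 1 := by
    simpa using integral_pow_gaussianC 0
  exact ⟨by rw [← ENNReal.toReal_eq_one_iff]; exact h2⟩

lemma integral_id_gaussianC : ∫ z, z ∂gaussianC = 0 := by
  rw [integral_gaussianC]
  have h := integral_neg_eq_self (fun z : ℂ => (Real.pi⁻¹ * Real.exp (-‖z‖ ^ 2)) • z) volume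
  simp only [norm_neg, smul_neg, integral_neg] at h
  exact self_eq_neg.1 h.symm

lemma charFun_gaussianC (t : ℂ) : charFun gaussianC t = Complex.exp (-(‖t‖ ^ 2 / 4 : ℝ)) := by
  rw [charFun_apply, integral_gaussianC]
  have := GaussianFourier.integral_cexp_neg_mul_sq_norm_add (b := 1) (by simp) Complex.I t
  have h : ∀ z : ℂ, (Real.pi⁻¹ * Real.exp (-‖z‖ ^ 2)) • Complex.exp (inner ℝ z t * Complex.I) =
      (Real.pi : ℂ)⁻¹ * Complex.exp (-1 * ‖z‖ ^ 2 + Complex.I * inner ℝ t z) := by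
    intro z
    rw [Complex.real_smul, Complex.exp_add, real_inner_comm]
    push_cast
    rw [mul_assoc, neg_one_mul, mul_comm Complex.I]
  simp_rw [h, integral_const_mul, this]
  rw [Complex.finrank_real_complex]
  simp only [Nat.cast_ofNat, div_one, ne_eq, OfNat.ofNat_ne_zero, not_false_eq_true, div_self,
    Complex.cpow_one, Complex.I_sq]
  rw [← mul_assoc, inv_mul_cancel₀ (by exact_mod_cast Real.pi_ne_zero), one_mul]
  push_cast
  ring_nf

instance (n : ℕ) : IsProbabilityMeasure (complexGaussian n) := by
  unfold complexGaussian
  exact Measure.isProbabilityMeasure_map (Measurable.aemeasurable (by fun_prop))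

/-- The characteristic function of `complexGaussian`. -/
lemma integral_cexp_inner_complexGaussian {n : ℕ} (z : EuclideanSpace ℂ (Fin n)) :
    ∫ a, Complex.exp ((inner ℂ a z : ℂ).re * Complex.I) ∂complexGaussian n =
      Complex.exp (-(‖z‖ ^ 2 / 4 : ℝ)) := by
  have hm : Measurable fun p : (Fin n → ℝ) × (Fin n → ℝ) =>
      (WithLp.toLp 2 fun k => (p.1 k : ℂ) + (p.2 k : ℂ) * Complex.I :
        EuclideanSpace ℂ (Fin n)) := by fun_prop
  rw [complexGaussian, integral_map hm.aemeasurable (by fun_prop)]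
  have h : ∀ p : (Fin n → ℝ) × (Fin n → ℝ), Complex.exp ((inner ℂ (WithLp.toLp 2 fun k =>
      (p.1 k : ℂ) + (p.2 k : ℂ) * Complex.I : EuclideanSpace ℂ (Fin n)) z : ℂ).re * Complex.I) =
      (∏ k, Complex.exp ((z k).re * (p.1 k) * Complex.I)) *
        ∏ k, Complex.exp ((z k).im * (p.2 k) * Complex.I) := by
    intro p
    rw [← Complex.exp_sum, ← Complex.exp_sum, ← Complex.exp_add, ← Finset.sum_mul,
      ← Finset.sum_mul, ← add_mul, ← Finset.sum_add_distrib]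
    congr 2
    rw [PiLp.inner_apply, Complex.re_sum]
    push_cast
    refine Finset.sum_congr rfl fun k _ => ?_
    simp [Complex.mul_re]
  simp_rw [h]
  rw [integral_prod_mul (fun u : Fin n → ℝ => ∏ k, Complex.exp ((z k).re * (u k) * Complex.I))
    (fun u : Fin n → ℝ => ∏ k, Complex.exp ((z k).im * (u k) * Complex.I)),
    integral_fintype_prod_eq_prod (fun k (u : ℝ) => Complex.exp ((z k).re * u * Complex.I)),
    integral_fintype_prod_eq_prod (fun k (u : ℝ) => Complex.exp ((z k).im * u * Complex.I))]
  simp_rw [← charFun_apply_real, charFun_gaussianReal]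
  rw [← Complex.exp_sum, ← Complex.exp_sum, ← Complex.exp_add, ← Finset.sum_add_distrib,
    EuclideanSpace.norm_sq_eq]
  congr 1
  push_cast
  rw [Finset.sum_div, ← Finset.sum_neg_distrib]
  refine Finset.sum_congr rfl fun k _ => ?_
  have h3 : (‖z k‖ : ℂ) ^ 2 = (z k).re ^ 2 + (z k).im ^ 2 := by
    rw [← Complex.ofReal_pow, ← Complex.normSq_eq_norm_sq, Complex.normSq_apply]
    push_cast; ring
  rw [h3]
  simp
  ring

/-- Absorbing `t` into the vector reduces every characteristic function of inner products with `a`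
to the single integral `integral_cexp_inner_complexGaussian`. -/
lemma real_inner_inner_eq {n : ℕ} (a x : EuclideanSpace ℂ (Fin n)) (t : ℂ) :
    inner ℝ (inner ℂ a x) t = (inner ℂ a ((starRingEnd ℂ t) • x)).re := by
  rw [inner_smul_right, Complex.inner]
  generalize inner ℂ a x = w
  simp [Complex.mul_re]

lemma measurable_inner_left {n : ℕ} (x : EuclideanSpace ℂ (Fin n)) :
    Measurable fun a : EuclideanSpace ℂ (Fin n) => inner ℂ a x :=
  Continuous.measurable (by fun_prop)

lemma charFun_map_inner {n : ℕ} (x : EuclideanSpace ℂ (Fin n)) (t : ℂ) :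
    charFun ((complexGaussian n).map fun a => inner ℂ a x) t =
      Complex.exp (-((‖t‖ * ‖x‖) ^ 2 / 4 : ℝ)) := by
  rw [charFun_apply, integral_map (measurable_inner_left x).aemeasurable (by fun_prop)]
  simp_rw [real_inner_inner_eq, integral_cexp_inner_complexGaussian, norm_smul, RCLike.norm_conj]

/-- For a unit vector `x`, `⟨a, x⟩` is a standard complex Gaussian variable. -/
lemma map_inner_complexGaussian {n : ℕ} {x : EuclideanSpace ℂ (Fin n)} (hx : ‖x‖ = 1) :
    (complexGaussian n).map (fun a => inner ℂ a x) = gaussianC := by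
  have := Measure.isProbabilityMeasure_map (μ := complexGaussian n)
    (measurable_inner_left x).aemeasurable
  refine Measure.ext_of_charFun ?_
  ext t
  rw [charFun_map_inner, hx, mul_one, charFun_gaussianC]

/-- Inner products of a complex Gaussian vector with orthogonal vectors are independent. -/
lemma indepFun_inner {n : ℕ} {x w : EuclideanSpace ℂ (Fin n)} (h : inner ℂ x w = 0) :
    IndepFun (fun a => inner ℂ a x) (fun a => inner ℂ a w) (complexGaussian n) := by
  rw [indepFun_iff_charFun_prod (measurable_inner_left x).aemeasurable
    (measurable_inner_left w).aemeasurable]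
  intro t
  rw [charFun_map_inner, charFun_map_inner, charFun_apply, integral_map]
  rotate_left
  · refine Measurable.aemeasurable ?_
    exact (WithLp.measurable_toLp _ _).comp
      ((measurable_inner_left x).prodMk (measurable_inner_left w))
  · fun_prop
  simp_rw [WithLp.prod_inner_apply, real_inner_inner_eq, ← Complex.add_re, ← inner_add_right,
    integral_cexp_inner_complexGaussian]
  rw [← Complex.exp_add]
  congr 1
  -- By orthogonality the squared norm in the exponent splits, so the joint characteristic function
  -- factors.
  rw [@norm_add_sq ℂ, inner_smul_left, inner_smul_right, h, norm_smul, norm_smul, RCLike.norm_conj,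
    RCLike.norm_conj]
  push_cast
  simp
  ring

lemma measurable_sign : Measurable Real.sign := by
  unfold Real.sign
  exact Measurable.ite measurableSet_Iio measurable_const
    (Measurable.ite measurableSet_Ioi measurable_const measurable_const)

lemma abs_sign_le_one (x : ℝ) : |Real.sign x| ≤ 1 := by
  rcases Real.sign_apply_eq x with h | h | h <;> simp [h]

section Moments

variable {n : ℕ} {x : EuclideanSpace ℂ (Fin n)}

lemma integral_norm_inner_pow (hx : ‖x‖ = 1) (k : ℕ) :
    ∫ a, ‖inner ℂ a x‖ ^ (2 * k) ∂complexGaussian n = k.factorial := by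
  rw [← integral_pow_gaussianC, ← map_inner_complexGaussian hx,
    integral_map (measurable_inner_left x).aemeasurable (by fun_prop)]

lemma integrable_norm_inner_pow (hx : ‖x‖ = 1) (k : ℕ) :
    Integrable (fun a => ‖inner ℂ a x‖ ^ (2 * k)) (complexGaussian n) := by
  refine .of_integral_ne_zero ?_
  rw [integral_norm_inner_pow hx]
  positivity

lemma integral_exp_norm_inner (hx : ‖x‖ = 1) :
    ∫ a, Real.exp (‖inner ℂ a x‖ ^ 2 / 2) ∂complexGaussian n = 2 := by
  have := integral_exp_gaussianC
  rwa [← map_inner_complexGaussian hx,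
    integral_map (measurable_inner_left x).aemeasurable (by fun_prop)] at this

lemma integrable_exp_norm_inner (hx : ‖x‖ = 1) :
    Integrable (fun a => Real.exp (‖inner ℂ a x‖ ^ 2 / 2)) (complexGaussian n) := by
  refine .of_integral_ne_zero ?_
  rw [integral_exp_norm_inner hx]
  norm_num

lemma integral_inner (hx : ‖x‖ = 1) : ∫ a, inner ℂ a x ∂complexGaussian n = 0 := by
  rw [← integral_id_gaussianC, ← map_inner_complexGaussian hx,
    integral_map (measurable_inner_left x).aemeasurable (by fun_prop)]

lemma exists_unit_smul (w : EuclideanSpace ℂ (Fin n)) (hw : w ≠ 0) :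
    ∃ v : EuclideanSpace ℂ (Fin n), ‖v‖ = 1 ∧ w = (‖w‖ : ℂ) • v := by
  have h : (‖w‖ : ℂ) ≠ 0 := by simpa using hw
  refine ⟨(‖w‖ : ℂ)⁻¹ • w, ?_, by rw [smul_smul, mul_inv_cancel₀ h, one_smul]⟩
  rw [norm_smul, norm_inv, Complex.norm_real, norm_norm, inv_mul_cancel₀ (by simpa using hw)]

lemma integral_norm_inner_sq (w : EuclideanSpace ℂ (Fin n)) :
    ∫ a, ‖inner ℂ a w‖ ^ 2 ∂complexGaussian n = ‖w‖ ^ 2 := by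
  rcases eq_or_ne w 0 with rfl | hw
  · simp
  obtain ⟨v, hv, h⟩ := exists_unit_smul w hw
  have := integral_norm_inner_pow hv 1
  simp only [mul_one, Nat.factorial_one, Nat.cast_one] at this
  rw [h]
  simp_rw [inner_smul_right, norm_mul, mul_pow, integral_const_mul, this]
  simp [norm_smul, hv]

lemma integrable_norm_inner_sq (w : EuclideanSpace ℂ (Fin n)) :
    Integrable (fun a => ‖inner ℂ a w‖ ^ 2) (complexGaussian n) := by
  rcases eq_or_ne w 0 with rfl | hw
  · simp
  · refine .of_integral_ne_zero ?_
    rw [integral_norm_inner_sq]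
    have := norm_pos_iff.2 hw
    positivity

lemma integral_inner_eq_zero (w : EuclideanSpace ℂ (Fin n)) :
    ∫ a, inner ℂ a w ∂complexGaussian n = 0 := by
  rcases eq_or_ne w 0 with rfl | hw
  · simp
  obtain ⟨v, hv, h⟩ := exists_unit_smul w hw
  rw [h]
  simp_rw [inner_smul_right, integral_const_mul, integral_inner hv, mul_zero]

end Moments

/-! ### The mean of one summand for fixed noise. -/

/-- Weighted second moments of `⟨a, x⟩` when the weight depends only on `⟨a, x₀⟩`. -/
lemma integral_weight_mul_norm_inner_sq {n : ℕ} {x₀ x : EuclideanSpace ℂ (Fin n)}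
    (hx₀ : ‖x₀‖ = 1) (hx : ‖x‖ = 1) {s : ℂ → ℝ} (hs : Measurable s) (hs1 : ∀ z, |s z| ≤ 1) :
    ∫ a, s (inner ℂ a x₀) * ‖inner ℂ a x‖ ^ 2 ∂complexGaussian n =
      ‖inner ℂ x₀ x‖ ^ 2 * ∫ a, s (inner ℂ a x₀) * ‖inner ℂ a x₀‖ ^ 2 ∂complexGaussian n +
      (1 - ‖inner ℂ x₀ x‖ ^ 2) * ∫ a, s (inner ℂ a x₀) ∂complexGaussian n := by
  set α := inner ℂ x₀ x with hα
  set w := x - α • x₀ with hw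
  have horth : inner ℂ x₀ w = 0 := by
    rw [hw, inner_sub_right, inner_smul_right, inner_self_eq_norm_sq_to_K, hx₀]; simp [hα]
  have hxw : x = α • x₀ + w := by rw [hw]; abel
  have hnw : ‖w‖ ^ 2 = 1 - ‖α‖ ^ 2 := by
    have h1 : ‖x‖ ^ 2 = ‖α • x₀‖ ^ 2 + ‖w‖ ^ 2 := by
      have := norm_add_sq_eq_norm_sq_add_norm_sq_of_inner_eq_zero (α • x₀) w (𝕜 := ℂ)
        (by rw [inner_smul_left, horth, mul_zero])
      rw [hxw, sq, sq, sq]; exact this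
    rw [hx, norm_smul, hx₀] at h1
    linarith
  have hind := indepFun_inner horth
  have m0 := measurable_inner_left x₀
  have mw := measurable_inner_left w
  have hsm : Measurable fun a : EuclideanSpace ℂ (Fin n) => s (inner ℂ a x₀) := hs.comp m0
  have hbd : ∀ f : EuclideanSpace ℂ (Fin n) → ℝ, Integrable f (complexGaussian n) →
      Integrable (fun a => s (inner ℂ a x₀) * f a) (complexGaussian n) := fun f hf =>
    hf.bdd_mul (c := 1) hsm.aestronglyMeasurable (.of_forall fun a => hs1 _)
  have e1 : ∫ a, s (inner ℂ a x₀) * ‖inner ℂ a w‖ ^ 2 ∂complexGaussian n =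
      (∫ a, s (inner ℂ a x₀) ∂complexGaussian n) * (1 - ‖α‖ ^ 2) := by
    rw [hind.integral_fun_comp_mul_comp (f := s) (g := fun z => ‖z‖ ^ 2) m0.aemeasurable
      mw.aemeasurable hs.aestronglyMeasurable (by fun_prop), integral_norm_inner_sq, hnw]
  -- The cross term vanishes: `⟨a, w⟩` is centered and independent of `⟨a, x₀⟩`.
  have e2 : ∫ a, ((s (inner ℂ a x₀) : ℂ) * (starRingEnd ℂ) (α * inner ℂ a x₀)) * inner ℂ a w
      ∂complexGaussian n = 0 := by
    have := hind.integral_fun_comp_mul_comp (f := fun z => ((s z : ℂ) * (starRingEnd ℂ) (α * z)))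
      (g := fun z => z) m0.aemeasurable mw.aemeasurable
      (by
        refine Measurable.aestronglyMeasurable ?_
        exact (Complex.measurable_ofReal.comp hs).mul
          (Continuous.measurable (by fun_prop))) (by fun_prop)
    rw [this, integral_inner_eq_zero, mul_zero]
  have i0 := hbd _ (integrable_norm_inner_sq x₀)
  have iw := hbd _ (integrable_norm_inner_sq w)
  have ix := hbd _ (integrable_norm_inner_sq x)
  have hpt : ∀ a : EuclideanSpace ℂ (Fin n), 2 * ((s (inner ℂ a x₀) : ℂ) *
      (starRingEnd ℂ) (α * inner ℂ a x₀) * inner ℂ a w).re =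
      s (inner ℂ a x₀) * ‖inner ℂ a x‖ ^ 2 - ‖α‖ ^ 2 * (s (inner ℂ a x₀) * ‖inner ℂ a x₀‖ ^ 2) -
        s (inner ℂ a x₀) * ‖inner ℂ a w‖ ^ 2 := by
    intro a
    have : (inner ℂ a x : ℂ) = α * inner ℂ a x₀ + inner ℂ a w := by
      conv_lhs => rw [hxw, inner_add_right, inner_smul_right]
    rw [this]
    generalize (inner ℂ a x₀ : ℂ) = g
    generalize (inner ℂ a w : ℂ) = h
    simp only [← Complex.normSq_eq_norm_sq, Complex.normSq_apply, Complex.mul_re, Complex.mul_im,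
      Complex.add_re, Complex.add_im, Complex.ofReal_re, Complex.ofReal_im, Complex.conj_re,
      Complex.conj_im]
    ring
  have hint : Integrable (fun a => (s (inner ℂ a x₀) : ℂ) * (starRingEnd ℂ) (α * inner ℂ a x₀) *
      inner ℂ a w) (complexGaussian n) := by
    refine ((integrable_norm_inner_sq x₀).const_mul (‖α‖ ^ 2) |>.add
      (integrable_norm_inner_sq w)).mono' ?_ (.of_forall fun a => ?_)
    · refine Measurable.aestronglyMeasurable ?_
      refine ((Complex.measurable_ofReal.comp hsm).mul ?_).mul mw
      exact Continuous.measurable (by fun_prop)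
    · simp only [norm_mul, Complex.norm_real, RCLike.norm_conj, Pi.add_apply, Real.norm_eq_abs]
      have h1 := hs1 (inner ℂ a x₀)
      have h2 : 0 ≤ ‖α‖ * ‖(inner ℂ a x₀ : ℂ)‖ * ‖(inner ℂ a w : ℂ)‖ := by positivity
      have h3 := two_mul_le_add_sq (‖α‖ * ‖(inner ℂ a x₀ : ℂ)‖) ‖(inner ℂ a w : ℂ)‖
      nlinarith [mul_le_mul_of_nonneg_right h1 h2]
  have e3 : ∫ a, 2 * ((s (inner ℂ a x₀) : ℂ) *
      (starRingEnd ℂ) (α * inner ℂ a x₀) * inner ℂ a w).re ∂complexGaussian n = 0 := by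
    have h := integral_re (𝕜 := ℂ) hint
    rw [e2] at h
    rw [integral_const_mul]
    simp only [RCLike.re_to_complex] at h
    rw [h]; simp
  simp_rw [hpt] at e3
  have ij : Integrable (fun a => s (inner ℂ a x₀) * ‖inner ℂ a x‖ ^ 2 -
      ‖α‖ ^ 2 * (s (inner ℂ a x₀) * ‖inner ℂ a x₀‖ ^ 2)) (complexGaussian n) :=
    ix.sub (i0.const_mul _)
  rw [integral_sub ij iw, integral_sub ix (i0.const_mul _),
    integral_const_mul, e1] at e3
  linarith

/-- The mean of one summand of the quadratic form, the noise difference `c` being fixed. -/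
lemma integral_sign_mul_sub {n : ℕ} {x₀ x : EuclideanSpace ℂ (Fin n)}
    (hx₀ : ‖x₀‖ = 1) (hx : ‖x‖ = 1) (c : ℝ) :
    ∫ p, Real.sign (‖inner ℂ p.1 x₀‖ ^ 2 - ‖inner ℂ p.2 x₀‖ ^ 2 + c) *
        (‖inner ℂ p.1 x‖ ^ 2 - ‖inner ℂ p.2 x‖ ^ 2)
        ∂(complexGaussian n).prod (complexGaussian n) =
      ‖inner ℂ x₀ x‖ ^ 2 *
        ∫ p, Real.sign (‖inner ℂ p.1 x₀‖ ^ 2 - ‖inner ℂ p.2 x₀‖ ^ 2 + c) *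
          (‖inner ℂ p.1 x₀‖ ^ 2 - ‖inner ℂ p.2 x₀‖ ^ 2)
          ∂(complexGaussian n).prod (complexGaussian n) := by
  set μ := complexGaussian n with hμ
  set S : EuclideanSpace ℂ (Fin n) × EuclideanSpace ℂ (Fin n) → ℝ := fun p =>
    Real.sign (‖inner ℂ p.1 x₀‖ ^ 2 - ‖inner ℂ p.2 x₀‖ ^ 2 + c) with hS
  have hSm : Measurable S := measurable_sign.comp (Continuous.measurable (by fun_prop))
  have hbd : ∀ f : EuclideanSpace ℂ (Fin n) × EuclideanSpace ℂ (Fin n) → ℝ,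
      Integrable f (μ.prod μ) → Integrable (fun p => S p * f p) (μ.prod μ) := fun f hf =>
    hf.bdd_mul (c := 1) hSm.aestronglyMeasurable (.of_forall fun a => abs_sign_le_one _)
  have hS1 : Integrable S (μ.prod μ) := by
    simpa using hbd (fun _ => 1) (integrable_const _)
  have i1 : ∀ z, Integrable (fun p => S p * ‖inner ℂ p.1 z‖ ^ 2) (μ.prod μ) := fun z =>
    hbd _ ((integrable_norm_inner_sq z).comp_fst μ)
  have i2 : ∀ z, Integrable (fun p => S p * ‖inner ℂ p.2 z‖ ^ 2) (μ.prod μ) := fun z =>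
    hbd _ ((integrable_norm_inner_sq z).comp_snd μ)
  have e1 : ∫ p, S p * ‖inner ℂ p.1 x‖ ^ 2 ∂μ.prod μ =
      ‖inner ℂ x₀ x‖ ^ 2 * ∫ p, S p * ‖inner ℂ p.1 x₀‖ ^ 2 ∂μ.prod μ +
        (1 - ‖inner ℂ x₀ x‖ ^ 2) * ∫ p, S p ∂μ.prod μ := by
    -- With the other sensing vector fixed, the sign is a bounded weight depending only on `⟨a,
    -- x₀⟩`.
    rw [integral_prod_symm _ (i1 x), integral_prod_symm _ (i1 x₀), integral_prod_symm _ hS1,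
      ← integral_const_mul, ← integral_const_mul, ← integral_add
      ((i1 x₀).integral_prod_right.const_mul _) (hS1.integral_prod_right.const_mul _)]
    refine integral_congr_ae (.of_forall fun b => ?_)
    exact integral_weight_mul_norm_inner_sq hx₀ hx
      (s := fun z => Real.sign (‖z‖ ^ 2 - ‖inner ℂ b x₀‖ ^ 2 + c))
      (measurable_sign.comp (by fun_prop)) fun z => abs_sign_le_one _
  have e2 : ∫ p, S p * ‖inner ℂ p.2 x‖ ^ 2 ∂μ.prod μ =
      ‖inner ℂ x₀ x‖ ^ 2 * ∫ p, S p * ‖inner ℂ p.2 x₀‖ ^ 2 ∂μ.prod μ +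
        (1 - ‖inner ℂ x₀ x‖ ^ 2) * ∫ p, S p ∂μ.prod μ := by
    rw [integral_prod _ (i2 x), integral_prod _ (i2 x₀), integral_prod _ hS1,
      ← integral_const_mul, ← integral_const_mul, ← integral_add
      ((i2 x₀).integral_prod_left.const_mul _) (hS1.integral_prod_left.const_mul _)]
    refine integral_congr_ae (.of_forall fun b => ?_)
    exact integral_weight_mul_norm_inner_sq hx₀ hx
      (s := fun z => Real.sign (‖inner ℂ b x₀‖ ^ 2 - ‖z‖ ^ 2 + c))
      (measurable_sign.comp (by fun_prop)) fun z => abs_sign_le_one _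
  -- The isotropic terms `(1 - |⟨x₀, x⟩|²) ∫ S` of `e1` and `e2` coincide and cancel in the
  -- difference.
  simp_rw [mul_sub]
  rw [integral_sub (i1 x) (i2 x), integral_sub (i1 x₀) (i2 x₀), e1, e2]
  ring

/-! ### Averaging the sign over exponential noise. -/

section Noise

variable {γ : ℝ}

lemma integral_expMeasure (hγ : 0 < γ) (f : ℝ → ℝ) :
    ∫ u, f u ∂expMeasure γ = ∫ u in Set.Ioi 0, γ * Real.exp (-(γ * u)) * f u := by
  have h : expMeasure γ = volume.withDensity (exponentialPDF γ) := rfl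
  have hm : Measurable (exponentialPDF γ) := (measurable_exponentialPDFReal γ).ennreal_ofReal
  rw [h, integral_withDensity_eq_integral_toReal_smul hm (by simp [exponentialPDF]),
    ← integral_Ici_eq_integral_Ioi, ← integral_indicator measurableSet_Ici]
  refine integral_congr_ae (.of_forall fun u => ?_)
  simp only [exponentialPDF_eq, Set.indicator, Set.mem_Ici, smul_eq_mul]
  split_ifs with hu
  · rw [ENNReal.toReal_ofReal (by positivity)]
  · simp

lemma expMeasure_real_Ici (hγ : 0 < γ) {u : ℝ} (hu : 0 ≤ u) :
    (expMeasure γ).real (Set.Ici u) = Real.exp (-(γ * u)) := by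
  have := isProbabilityMeasure_expMeasure hγ
  have h1 := cdf_expMeasure_eq hγ u
  rw [if_pos hu, cdf_eq_real] at h1
  have h0 : expMeasure γ {u} = 0 :=
    withDensity_absolutelyContinuous (μ := volume) (exponentialPDF γ) (by simp)
  have h2 : (expMeasure γ).real (Set.Ici u) = (expMeasure γ).real (Set.Iic u)ᶜ := by
    rw [Set.compl_Iic]
    refine measureReal_congr ?_
    have : Set.Ici u = Set.Ioi u ∪ {u} := by rw [Set.union_singleton, Set.Ioi_insert]
    rw [this]
    exact union_ae_eq_left_of_ae_eq_empty (ae_eq_empty.2 h0)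
  rw [h2, probReal_compl_eq_one_sub measurableSet_Iic, h1]
  ring

lemma ae_nonneg_expMeasure (hγ : 0 < γ) : ∀ᵐ u ∂expMeasure γ, 0 ≤ u := by
  have := isProbabilityMeasure_expMeasure hγ
  have h := expMeasure_real_Ici hγ le_rfl
  rw [mul_zero, neg_zero, Real.exp_zero] at h
  have h2 : expMeasure γ (Set.Ici 0) = 1 := by
    rw [measureReal_def, ENNReal.toReal_eq_one_iff] at h; exact h
  exact (prob_compl_eq_zero_iff measurableSet_Ici).2 h2

lemma integral_exp_neg_expMeasure (hγ : 0 < γ) :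
    ∫ u, Real.exp (-(γ * u)) ∂expMeasure γ = 1 / 2 := by
  rw [integral_expMeasure hγ]
  have h : ∀ u : ℝ, γ * Real.exp (-(γ * u)) * Real.exp (-(γ * u)) =
      γ * Real.exp (-(2 * γ) * u) := fun u => by
    rw [mul_assoc, ← Real.exp_add]; ring_nf
  simp_rw [h, integral_const_mul]
  rw [integral_exp_mul_Ioi (by linarith)]
  simp
  field_simp

lemma integrable_sign_noise (hγ : 0 < γ) (d : ℝ) :
    Integrable (fun p : ℝ × ℝ => Real.sign (d + (p.1 - p.2)))
      ((expMeasure γ).prod (expMeasure γ)) := by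
  have := isProbabilityMeasure_expMeasure hγ
  exact .of_bound (C := 1) (measurable_sign.comp (by fun_prop)).aestronglyMeasurable
    (.of_forall fun a => abs_sign_le_one _)

/-- For noises `u`, `v` the sign is at least `1 - 2 · 1{v ≥ d + u}`. The event has probability
`exp(-γ (d + u))` given `u ≥ 0`, and `exp(-γ u)` has mean `1/2`. -/
lemma le_integral_sign_noise (hγ : 0 < γ) {d : ℝ} (hd : 0 ≤ d) :
    1 - Real.exp (-(γ * d)) ≤
      ∫ p : ℝ × ℝ, Real.sign (d + (p.1 - p.2)) ∂(expMeasure γ).prod (expMeasure γ) := by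
  have := isProbabilityMeasure_expMeasure hγ
  have hi := integrable_sign_noise hγ d
  rw [integral_prod _ hi]
  have hint : Integrable (fun u => Real.exp (-(γ * u))) (expMeasure γ) := by
    refine .of_integral_ne_zero ?_
    rw [integral_exp_neg_expMeasure hγ]; norm_num
  have h1 : ∫ u, (1 - 2 * Real.exp (-(γ * d)) * Real.exp (-(γ * u))) ∂expMeasure γ =
      1 - Real.exp (-(γ * d)) := by
    rw [integral_sub (integrable_const _) (hint.const_mul _), integral_const_mul,
      integral_exp_neg_expMeasure hγ]
    simp
    ring
  rw [← h1]
  refine integral_mono_ae ((integrable_const _).sub (hint.const_mul _)) hi.integral_prod_left ?_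
  filter_upwards [ae_nonneg_expMeasure hγ] with u hu
  have hdu : 0 ≤ d + u := by linarith
  have h2 : ∫ v, (1 - 2 * (Set.Ici (d + u)).indicator (fun _ => (1 : ℝ)) v) ∂expMeasure γ =
      1 - 2 * Real.exp (-(γ * d)) * Real.exp (-(γ * u)) := by
    rw [integral_sub (integrable_const _)
      (((integrable_const _).indicator measurableSet_Ici).const_mul _), integral_const_mul,
      integral_indicator_const _ measurableSet_Ici, expMeasure_real_Ici hγ hdu, mul_assoc,
      ← Real.exp_add]
    simp
    ring_nf
  rw [← h2]
  refine integral_mono ((integrable_const _).sub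
      (((integrable_const _).indicator measurableSet_Ici).const_mul _))
    (.of_bound (C := 1) (measurable_sign.comp (by fun_prop)).aestronglyMeasurable
      (.of_forall fun a => abs_sign_le_one _)) fun v => ?_
  simp only [Set.indicator, Set.mem_Ici]
  split_ifs with h
  · have := (abs_le.1 (abs_sign_le_one (d + (u - v)))).1
    linarith
  · rw [Real.sign_of_pos (by linarith)]; norm_num

/-- Exchanging the two identically distributed noises negates their difference, and the sign is odd.
-/
lemma integral_sign_noise_neg (d : ℝ) [SFinite (expMeasure γ)] :
    ∫ p : ℝ × ℝ, Real.sign (-d + (p.1 - p.2)) ∂(expMeasure γ).prod (expMeasure γ) =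
      -∫ p : ℝ × ℝ, Real.sign (d + (p.1 - p.2)) ∂(expMeasure γ).prod (expMeasure γ) := by
  rw [← integral_prod_swap, ← integral_neg]
  refine integral_congr_ae (.of_forall fun p => ?_)
  simp only [Prod.fst_swap, Prod.snd_swap]
  rw [← Real.sign_neg]
  congr 1
  ring

lemma mul_integral_sign_noise_ge (hγ : 0 < γ) (d : ℝ) :
    |d| * (1 - Real.exp (-(γ * |d|))) ≤
      d * ∫ p : ℝ × ℝ, Real.sign (d + (p.1 - p.2)) ∂(expMeasure γ).prod (expMeasure γ) := by
  have := isProbabilityMeasure_expMeasure hγ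
  rcases le_total 0 d with hd | hd
  · rw [abs_of_nonneg hd]
    exact mul_le_mul_of_nonneg_left (le_integral_sign_noise hγ hd) hd
  · have h := integral_sign_noise_neg (γ := γ) (-d)
    rw [neg_neg] at h
    have hd' : 0 ≤ -d := by linarith
    have := mul_le_mul_of_nonneg_left (le_integral_sign_noise hγ hd') hd'
    rw [abs_of_nonpos hd, h]
    linarith

/-- A polynomial lower bound for the mean response to a gap `d`. -/
lemma mul_integral_sign_noise_ge_poly (hγ : 0 < γ) (d τ : ℝ) :
    2 * τ * d ^ 2 - τ ^ 2 * (d ^ 2 / γ + (d ^ 2 + d ^ 4) / 2) ≤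
      d * ∫ p : ℝ × ℝ, Real.sign (d + (p.1 - p.2)) ∂(expMeasure γ).prod (expMeasure γ) := by
  refine le_trans ?_ (mul_integral_sign_noise_ge hγ d)
  have h0 := abs_nonneg d
  have hd2 : d ^ 2 = |d| ^ 2 := (sq_abs d).symm
  have hd4 : d ^ 4 = |d| ^ 4 := by rw [show d ^ 4 = (d ^ 2) ^ 2 by ring, hd2]; ring
  rw [hd2, hd4]
  generalize |d| = r at h0
  -- Equivalent to `1 + γ r ≤ exp(γ r)`.
  have h1 : γ * r / (1 + γ * r) ≤ 1 - Real.exp (-(γ * r)) := by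
    have hx : 0 ≤ γ * r := by positivity
    have := Real.add_one_le_exp (γ * r)
    rw [Real.exp_neg]
    have h2 : (Real.exp (γ * r))⁻¹ ≤ (1 + γ * r)⁻¹ := by
      gcongr; linarith
    have h3 : γ * r / (1 + γ * r) = 1 - (1 + γ * r)⁻¹ := by field_simp; ring
    linarith
  have h4 : r ^ 2 / (1 / γ + r) ≤ r * (1 - Real.exp (-(γ * r))) := by
    have : r ^ 2 / (1 / γ + r) = r * (γ * r / (1 + γ * r)) := by field_simp
    rw [this]
    exact mul_le_mul_of_nonneg_left h1 h0
  refine le_trans ?_ h4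
  have hq : 0 < 1 / γ + r := by positivity
  -- The convex function `q ↦ 1/q` lies above its tangent at `1/τ`. This removes the denominator, so
  -- that only moments of the gap are needed.
  have h5 : 2 * τ - τ ^ 2 * (1 / γ + r) ≤ 1 / (1 / γ + r) := by
    rw [le_div_iff₀ hq]
    nlinarith [sq_nonneg (τ * (1 / γ + r) - 1)]
  have h6 : r ^ 2 * (2 * τ - τ ^ 2 * (1 / γ + r)) ≤ r ^ 2 / (1 / γ + r) := by
    rw [div_eq_mul_one_div (r ^ 2)]
    exact mul_le_mul_of_nonneg_left h5 (sq_nonneg r)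
  refine le_trans ?_ h6
  -- The odd power is traded for even ones, whose Gaussian moments are explicit.
  have h7 : r ^ 2 * r ≤ (r ^ 2 + r ^ 4) / 2 := by nlinarith [mul_nonneg (sq_nonneg r) (sq_nonneg (r - 1))]
  have h8 := mul_le_mul_of_nonneg_left h7 (sq_nonneg τ)
  have h9 : r ^ 2 / γ = r ^ 2 * (1 / γ) := by ring
  rw [h9]
  nlinarith

end Noise

/-! ### The signal strength. -/

/-- The law of the two sensing vectors and the two noise variables of one measurement. -/
def pairLaw (n : ℕ) (γ : ℝ) :
    Measure ((EuclideanSpace ℂ (Fin n) × EuclideanSpace ℂ (Fin n)) × (ℝ × ℝ)) :=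
  ((complexGaussian n).prod (complexGaussian n)).prod ((expMeasure γ).prod (expMeasure γ))

/-- The one-bit measurement as a function of sensing vectors and noise. -/
def bit {n : ℕ} (x₀ : EuclideanSpace ℂ (Fin n))
    (q : (EuclideanSpace ℂ (Fin n) × EuclideanSpace ℂ (Fin n)) × (ℝ × ℝ)) : ℝ :=
  Real.sign (‖inner ℂ q.1.1 x₀‖ ^ 2 - ‖inner ℂ q.1.2 x₀‖ ^ 2 + (q.2.1 - q.2.2))

/-- The difference of the noiseless intensities in direction `x`. -/
def gap {n : ℕ} (x : EuclideanSpace ℂ (Fin n))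
    (p : EuclideanSpace ℂ (Fin n) × EuclideanSpace ℂ (Fin n)) : ℝ :=
  ‖inner ℂ p.1 x‖ ^ 2 - ‖inner ℂ p.2 x‖ ^ 2

/-- The signal strength: the eigenvalue of the mean of `Ĉₘ` at `x₀`. -/
def signal {n : ℕ} (γ : ℝ) (x₀ : EuclideanSpace ℂ (Fin n)) : ℝ :=
  ∫ q, bit x₀ q * gap x₀ q.1 ∂pairLaw n γ

lemma measurable_gap {n : ℕ} (x : EuclideanSpace ℂ (Fin n)) : Measurable (gap x) :=
  Continuous.measurable (by unfold gap; fun_prop)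

lemma measurable_bit {n : ℕ} (x₀ : EuclideanSpace ℂ (Fin n)) : Measurable (bit x₀) :=
  measurable_sign.comp (Continuous.measurable (by fun_prop))

lemma integrable_gap {n : ℕ} (x : EuclideanSpace ℂ (Fin n)) :
    Integrable (gap x) ((complexGaussian n).prod (complexGaussian n)) :=
  ((integrable_norm_inner_sq x).comp_fst _).sub ((integrable_norm_inner_sq x).comp_snd _)

lemma integrable_bit_mul_gap {n : ℕ} {γ : ℝ} (hγ : 0 < γ) (x₀ x : EuclideanSpace ℂ (Fin n)) :
    Integrable (fun q => bit x₀ q * gap x q.1) (pairLaw n γ) := by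
  have := isProbabilityMeasure_expMeasure hγ
  have h : Integrable (fun q : (EuclideanSpace ℂ (Fin n) × EuclideanSpace ℂ (Fin n)) × (ℝ × ℝ) =>
      gap x q.1) (pairLaw n γ) := (integrable_gap x).comp_fst _
  exact h.bdd_mul (c := 1) (measurable_bit x₀).aestronglyMeasurable
    (.of_forall fun a => abs_sign_le_one _)

/-- The mean of one summand of the quadratic form of `Ĉₘ`. -/
lemma integral_bit_mul_gap {n : ℕ} {γ : ℝ} (hγ : 0 < γ) {x₀ x : EuclideanSpace ℂ (Fin n)}
    (hx₀ : ‖x₀‖ = 1) (hx : ‖x‖ = 1) :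
    ∫ q, bit x₀ q * gap x q.1 ∂pairLaw n γ = ‖inner ℂ x₀ x‖ ^ 2 * signal γ x₀ := by
  have := isProbabilityMeasure_expMeasure hγ
  have h1 := integrable_bit_mul_gap hγ x₀ x
  have h2 := integrable_bit_mul_gap hγ x₀ x₀
  unfold pairLaw at h1 h2
  rw [signal, pairLaw, integral_prod_symm _ h1, integral_prod_symm _ h2, ← integral_const_mul]
  exact integral_congr_ae (.of_forall fun v => integral_sign_mul_sub hx₀ hx (v.1 - v.2))

lemma signal_eq {n : ℕ} {γ : ℝ} (hγ : 0 < γ) (x₀ : EuclideanSpace ℂ (Fin n)) :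
    signal γ x₀ = ∫ p, gap x₀ p * ∫ v : ℝ × ℝ, Real.sign (gap x₀ p + (v.1 - v.2))
      ∂(expMeasure γ).prod (expMeasure γ) ∂(complexGaussian n).prod (complexGaussian n) := by
  have := isProbabilityMeasure_expMeasure hγ
  have h2 := integrable_bit_mul_gap hγ x₀ x₀
  unfold pairLaw at h2
  rw [signal, pairLaw, integral_prod _ h2]
  refine integral_congr_ae (.of_forall fun p => ?_)
  simp only
  rw [integral_mul_const, mul_comm]
  rfl

section GapMoments

variable {n : ℕ} {x : EuclideanSpace ℂ (Fin n)}

lemma gap_sq_eq (p : EuclideanSpace ℂ (Fin n) × EuclideanSpace ℂ (Fin n)) :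
    gap x p ^ 2 = ‖inner ℂ p.1 x‖ ^ (2 * 2) + ‖inner ℂ p.2 x‖ ^ (2 * 2) -
      2 * (‖inner ℂ p.1 x‖ ^ (2 * 1) * ‖inner ℂ p.2 x‖ ^ (2 * 1)) := by
  unfold gap; ring

lemma integrable_gap_sq (hx : ‖x‖ = 1) :
    Integrable (fun p => gap x p ^ 2) ((complexGaussian n).prod (complexGaussian n)) := by
  simp_rw [gap_sq_eq]
  have h1 := integrable_norm_inner_pow hx 1
  have h2 := integrable_norm_inner_pow hx 2
  exact ((h2.comp_fst _).add (h2.comp_snd _)).sub ((h1.mul_prod h1).const_mul 2)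

lemma integral_gap_sq (hx : ‖x‖ = 1) :
    ∫ p, gap x p ^ 2 ∂(complexGaussian n).prod (complexGaussian n) = 2 := by
  simp_rw [gap_sq_eq]
  have h1 := integrable_norm_inner_pow hx 1
  have h2 := integrable_norm_inner_pow hx 2
  have h3 : Integrable (fun p : EuclideanSpace ℂ (Fin n) × EuclideanSpace ℂ (Fin n) =>
    ‖inner ℂ p.1 x‖ ^ (2 * 2) + ‖inner ℂ p.2 x‖ ^ (2 * 2))
    ((complexGaussian n).prod (complexGaussian n)) := (h2.comp_fst _).add (h2.comp_snd _)
  rw [integral_sub h3 ((h1.mul_prod h1).const_mul 2),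
    integral_add (h2.comp_fst _) (h2.comp_snd _), integral_const_mul,
    integral_prod_mul (fun a => ‖inner ℂ a x‖ ^ (2 * 1)) (fun a => ‖inner ℂ a x‖ ^ (2 * 1)),
    integral_fun_fst (fun a => ‖inner ℂ a x‖ ^ (2 * 2)),
    integral_fun_snd (fun a => ‖inner ℂ a x‖ ^ (2 * 2)), integral_norm_inner_pow hx,
    integral_norm_inner_pow hx]
  norm_num [Nat.factorial]

lemma gap_pow_four_le (p : EuclideanSpace ℂ (Fin n) × EuclideanSpace ℂ (Fin n)) :
    gap x p ^ 4 ≤ ‖inner ℂ p.1 x‖ ^ (2 * 4) + ‖inner ℂ p.2 x‖ ^ (2 * 4) := by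
  unfold gap
  rw [pow_mul, pow_mul]
  have h1 := sq_nonneg ‖(inner ℂ p.1 x : ℂ)‖
  have h2 := sq_nonneg ‖(inner ℂ p.2 x : ℂ)‖
  generalize ‖(inner ℂ p.1 x : ℂ)‖ ^ 2 = u at *
  generalize ‖(inner ℂ p.2 x : ℂ)‖ ^ 2 = v at *
  rcases le_total u v with h | h
  · have : (v - u) ^ 4 ≤ v ^ 4 := pow_le_pow_left₀ (by linarith) (by linarith) 4
    have h4 : (u - v) ^ 4 = (v - u) ^ 4 := by ring
    have := pow_nonneg h1 4
    linarith
  · have : (u - v) ^ 4 ≤ u ^ 4 := pow_le_pow_left₀ (by linarith) (by linarith) 4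
    have := pow_nonneg h2 4
    linarith

lemma integrable_gap_pow_four (hx : ‖x‖ = 1) :
    Integrable (fun p => gap x p ^ 4) ((complexGaussian n).prod (complexGaussian n)) := by
  have h := integrable_norm_inner_pow hx 4
  refine ((h.comp_fst (complexGaussian n)).add (h.comp_snd (complexGaussian n))).mono'
    ((measurable_gap x).pow_const 4).aestronglyMeasurable (.of_forall fun p => ?_)
  rw [Real.norm_eq_abs, abs_of_nonneg (by positivity)]
  exact gap_pow_four_le p

lemma integral_gap_pow_four_le (hx : ‖x‖ = 1) :
    ∫ p, gap x p ^ 4 ∂(complexGaussian n).prod (complexGaussian n) ≤ 48 := by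
  have h := integrable_norm_inner_pow hx 4
  have h2 : ∫ p : EuclideanSpace ℂ (Fin n) × EuclideanSpace ℂ (Fin n), (‖inner ℂ p.1 x‖ ^ (2 * 4) +
      ‖inner ℂ p.2 x‖ ^ (2 * 4)) ∂(complexGaussian n).prod (complexGaussian n) = 48 := by
    rw [integral_add (h.comp_fst _) (h.comp_snd _),
      integral_fun_fst (fun a => ‖inner ℂ a x‖ ^ (2 * 4)),
      integral_fun_snd (fun a => ‖inner ℂ a x‖ ^ (2 * 4)), integral_norm_inner_pow hx]
    simp
    norm_num [Nat.factorial]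
  rw [← h2]
  exact integral_mono (integrable_gap_pow_four hx) ((h.comp_fst _).add (h.comp_snd _))
    gap_pow_four_le

end GapMoments

/-- The signal strength is at least of the order `1 / (1 + s)`, where `s = 1/γ`. -/
lemma signal_ge {n : ℕ} {γ : ℝ} (hγ : 0 < γ) {x₀ : EuclideanSpace ℂ (Fin n)} (hx₀ : ‖x₀‖ = 1) :
    1 / (10 * (1 + 1 / γ)) ≤ signal γ x₀ := by
  have := isProbabilityMeasure_expMeasure hγ
  have hs : 0 < 1 / γ := by positivity
  -- With second moment `2` and fourth moment at most `48`, the bound is at least `4τ - 25 τ² (1 +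
  -- 1/γ)`; for this `τ` it equals `3τ/2`.
  set τ := 1 / (10 * (1 + 1 / γ)) with hτ
  have i2 := integrable_gap_sq hx₀
  have i4 := integrable_gap_pow_four hx₀
  have ir : Integrable (fun p => τ ^ 2 * (gap x₀ p ^ 2 / γ + (gap x₀ p ^ 2 + gap x₀ p ^ 4) / 2))
    ((complexGaussian n).prod (complexGaussian n)) :=
    ((i2.div_const γ).add ((i2.add i4).div_const 2)).const_mul (τ ^ 2)
  have h1 : ∫ p, (2 * τ * gap x₀ p ^ 2 - τ ^ 2 * (gap x₀ p ^ 2 / γ +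
      (gap x₀ p ^ 2 + gap x₀ p ^ 4) / 2)) ∂(complexGaussian n).prod (complexGaussian n) ≤
      signal γ x₀ := by
    rw [signal_eq hγ]
    refine integral_mono ((i2.const_mul _).sub ir) ?_ fun p =>
      mul_integral_sign_noise_ge_poly hγ (gap x₀ p) τ
    have h2 := integrable_bit_mul_gap hγ x₀ x₀
    unfold pairLaw at h2
    refine h2.integral_prod_left.congr (.of_forall fun p => ?_)
    simp only
    rw [integral_mul_const, mul_comm]
    rfl
  refine le_trans ?_ h1
  have i24 : Integrable (fun p => (gap x₀ p ^ 2 + gap x₀ p ^ 4) / 2)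
    ((complexGaussian n).prod (complexGaussian n)) := (i2.add i4).div_const 2
  rw [integral_sub (i2.const_mul _) ir, integral_const_mul, integral_const_mul,
    integral_add (i2.div_const γ) i24, integral_div, integral_div,
    integral_add i2 i4, integral_gap_sq hx₀]
  have h4 := integral_gap_pow_four_le hx₀
  set I := ∫ p, gap x₀ p ^ 4 ∂(complexGaussian n).prod (complexGaussian n)
  have h5 : τ ^ 2 * (2 / γ + (2 + I) / 2) ≤ τ ^ 2 * (25 * (1 + 1 / γ)) := by
    refine mul_le_mul_of_nonneg_left ?_ (sq_nonneg τ)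
    have : 2 / γ = 2 * (1 / γ) := by ring
    rw [this]; linarith
  have h6 : τ * (10 * (1 + 1 / γ)) = 1 := by rw [hτ]; field_simp
  have hτ0 : 0 < τ := by positivity
  have h7 : τ ^ 2 * (25 * (1 + 1 / γ)) = 5 / 2 * τ := by linear_combination 5 / 2 * τ * h6
  linarith

/-- A crude bound; it keeps the deviation threshold in the range where the Bernstein estimate
applies. -/
lemma signal_le_two {n : ℕ} {γ : ℝ} (hγ : 0 < γ) {x₀ : EuclideanSpace ℂ (Fin n)}
    (hx₀ : ‖x₀‖ = 1) : signal γ x₀ ≤ 2 := by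
  have := isProbabilityMeasure_expMeasure hγ
  have h1 := (integrable_norm_inner_sq x₀)
  have i1 : Integrable (fun q : (EuclideanSpace ℂ (Fin n) × EuclideanSpace ℂ (Fin n)) × (ℝ × ℝ) =>
      ‖inner ℂ q.1.1 x₀‖ ^ 2 + ‖inner ℂ q.1.2 x₀‖ ^ 2) (pairLaw n γ) :=
    (((h1.comp_fst (complexGaussian n)).add (h1.comp_snd (complexGaussian n))).comp_fst
      ((expMeasure γ).prod (expMeasure γ)))
  have h2 : ∫ q, (‖inner ℂ q.1.1 x₀‖ ^ 2 + ‖inner ℂ q.1.2 x₀‖ ^ 2) ∂pairLaw n γ = 2 := by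
    rw [pairLaw, integral_fun_fst (fun p : EuclideanSpace ℂ (Fin n) × EuclideanSpace ℂ (Fin n) =>
      ‖inner ℂ p.1 x₀‖ ^ 2 + ‖inner ℂ p.2 x₀‖ ^ 2), integral_add (h1.comp_fst _) (h1.comp_snd _),
      integral_fun_fst (fun a => ‖inner ℂ a x₀‖ ^ 2),
      integral_fun_snd (fun a => ‖inner ℂ a x₀‖ ^ 2), integral_norm_inner_sq, hx₀]
    simp
    norm_num
  rw [← h2, signal]
  refine integral_mono (integrable_bit_mul_gap hγ x₀ x₀) i1 fun q => ?_
  have h3 := abs_sign_le_one (‖inner ℂ q.1.1 x₀‖ ^ 2 - ‖inner ℂ q.1.2 x₀‖ ^ 2 + (q.2.1 - q.2.2))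
  simp only [bit, gap]
  have h4 := sq_nonneg ‖(inner ℂ q.1.1 x₀ : ℂ)‖
  have h5 := sq_nonneg ‖(inner ℂ q.1.2 x₀ : ℂ)‖
  have := abs_le.1 h3
  nlinarith

/-! ### Sub-exponential moment generating functions. -/

lemma exp_le_one_add_add_sq_mul_exp_abs (u : ℝ) :
    Real.exp u ≤ 1 + u + u ^ 2 * Real.exp |u| := by
  have h := Complex.norm_exp_sub_sum_le_norm_mul_exp (u : ℂ) 2
  have h1 : Complex.exp u - ∑ m ∈ Finset.range 2, (u : ℂ) ^ m / (m.factorial : ℂ) =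
      ((Real.exp u - (1 + u) : ℝ) : ℂ) := by
    simp [Finset.sum_range_succ]
  rw [h1, Complex.norm_real, Complex.norm_real, Real.norm_eq_abs, Real.norm_eq_abs, sq_abs] at h
  linarith [le_abs_self (Real.exp u - (1 + u))]

/-- The pointwise bound behind the Bernstein estimate. -/
lemma exp_mul_le_of_abs_le_add {s X U V : ℝ} (hs : |s| ≤ 1 / 8) (hX : |X| ≤ U + V) :
    Real.exp (s * X) ≤ 1 + s * X + 64 * s ^ 2 * (Real.exp (U / 2) + Real.exp (V / 2)) := by
  refine (exp_le_one_add_add_sq_mul_exp_abs _).trans ?_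
  have h0 := abs_nonneg X
  have h1 : Real.exp |s * X| ≤ Real.exp (|X| / 8) := by
    rw [abs_mul]
    exact Real.exp_le_exp.2 (by nlinarith)
  -- This is `y² / 2 ≤ exp y` at `y = |X| / 8`.
  have h2 : X ^ 2 ≤ 128 * Real.exp (|X| / 8) := by
    have := Real.quadratic_le_exp_of_nonneg (x := |X| / 8) (by positivity)
    rw [div_pow, sq_abs] at this
    linarith
  -- The two exponentials combine to `exp(|X| / 4)`. The arithmetic-geometric mean inequality then
  -- separates `U` from `V`, so no independence between them is needed.
  have h3 : X ^ 2 * Real.exp |s * X| ≤ 64 * (Real.exp (U / 2) + Real.exp (V / 2)) := by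
    calc X ^ 2 * Real.exp |s * X| ≤ 128 * Real.exp (|X| / 8) * Real.exp (|X| / 8) := by gcongr
      _ = 128 * Real.exp (|X| / 4) := by rw [mul_assoc, ← Real.exp_add]; ring_nf
      _ ≤ 128 * (Real.exp (U / 4) * Real.exp (V / 4)) := by
        rw [← Real.exp_add]; gcongr; linarith
      _ ≤ 64 * (Real.exp (U / 4) ^ 2 + Real.exp (V / 4) ^ 2) := by
        nlinarith [sq_nonneg (Real.exp (U / 4) - Real.exp (V / 4))]
      _ = 64 * (Real.exp (U / 2) + Real.exp (V / 2)) := by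
        rw [← Real.exp_nat_mul, ← Real.exp_nat_mul]; push_cast; ring_nf
  have := mul_le_mul_of_nonneg_left h3 (sq_nonneg s)
  rw [mul_pow]
  linarith

section Bernstein

variable {Ω : Type*} [MeasurableSpace Ω] {P : Measure Ω} [IsProbabilityMeasure P]
  {X U V : Ω → ℝ}

lemma integrable_exp_mul_of_abs_le_add (hX : Integrable X P)
    (hU : Integrable (fun ω => Real.exp (U ω / 2)) P)
    (hV : Integrable (fun ω => Real.exp (V ω / 2)) P) (hXUV : ∀ ω, |X ω| ≤ U ω + V ω)
    {s : ℝ} (hs : |s| ≤ 1 / 8) : Integrable (fun ω => Real.exp (s * X ω)) P := by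
  refine (((integrable_const 1).add (hX.const_mul s)).add
    ((hU.add hV).const_mul (64 * s ^ 2))).mono' (by
      have := hX.aestronglyMeasurable
      exact (Real.continuous_exp.comp (continuous_const_mul s)).comp_aestronglyMeasurable this)
    (.of_forall fun ω => ?_)
  rw [Real.norm_eq_abs, Real.abs_exp]
  exact exp_mul_le_of_abs_le_add hs (hXUV ω)

/-- A sub-exponential moment generating function bound. -/
lemma mgf_le_of_abs_le_add (hX : Integrable X P)
    (hU : Integrable (fun ω => Real.exp (U ω / 2)) P)
    (hV : Integrable (fun ω => Real.exp (V ω / 2)) P)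
    (hU2 : ∫ ω, Real.exp (U ω / 2) ∂P ≤ 2) (hV2 : ∫ ω, Real.exp (V ω / 2) ∂P ≤ 2)
    (hXUV : ∀ ω, |X ω| ≤ U ω + V ω) {s : ℝ} (hs : |s| ≤ 1 / 8) :
    mgf X P s ≤ Real.exp (s * ∫ ω, X ω ∂P + 256 * s ^ 2) := by
  have h1 : mgf X P s ≤ ∫ ω, (1 + s * X ω +
      64 * s ^ 2 * (Real.exp (U ω / 2) + Real.exp (V ω / 2))) ∂P :=
    integral_mono (integrable_exp_mul_of_abs_le_add hX hU hV hXUV hs)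
      (((integrable_const 1).add (hX.const_mul s)).add ((hU.add hV).const_mul (64 * s ^ 2)))
      fun ω => exp_mul_le_of_abs_le_add hs (hXUV ω)
  have i1 : Integrable (fun ω => 1 + s * X ω) P := (integrable_const 1).add (hX.const_mul s)
  have i2 : Integrable (fun ω => 64 * s ^ 2 * (Real.exp (U ω / 2) + Real.exp (V ω / 2))) P :=
    (hU.add hV).const_mul (64 * s ^ 2)
  rw [integral_add i1 i2, integral_add (integrable_const 1) (hX.const_mul s), integral_const_mul,
    integral_const_mul, integral_add hU hV] at h1
  simp only [integral_const, probReal_univ, smul_eq_mul, mul_one] at h1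
  have h2 : 64 * s ^ 2 * (∫ ω, Real.exp (U ω / 2) ∂P + ∫ ω, Real.exp (V ω / 2) ∂P) ≤
      64 * s ^ 2 * 4 := by gcongr; linarith
  have := Real.add_one_le_exp (s * ∫ ω, X ω ∂P + 256 * s ^ 2)
  linarith

end Bernstein

/-! ### Independence of blocks and rearrangement of product measures. -/

/-- The moment generating function of a sum of functions of disjoint blocks of independent
variables is the product of the moment generating functions. -/
lemma mgf_sum_blocks {Ω ι κ 𝓧 : Type*} [MeasurableSpace Ω] {P : Measure Ω} [Fintype κ]
    [MeasurableSpace 𝓧] {W : ι × κ → Ω → 𝓧} (hW : iIndepFun W P)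
    (hm : ∀ q, AEMeasurable (W q) P) {f : (κ → 𝓧) → ℝ} (hf : Measurable f) (t : ℝ)
    (s : Finset ι) :
    mgf (∑ i ∈ s, fun ω => f fun k => W (i, k) ω) P t =
      ∏ i ∈ s, mgf (fun ω => f fun k => W (i, k) ω) P t := by
  classical
  have := hW.isProbabilityMeasure
  induction s using Finset.induction_on with
  | empty => simp
  | insert i s hi ih =>
    rw [Finset.sum_insert hi, Finset.prod_insert hi, ← ih]
    -- The new summand reads only the indices `{i} × κ` and the earlier ones only `s × κ`; disjoint
    -- index sets give independent tuples.
    have hdisj : Disjoint (({i} : Finset ι) ×ˢ (Finset.univ : Finset κ))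
        (s ×ˢ (Finset.univ : Finset κ)) := by
      rw [Finset.disjoint_product]
      exact .inl (Finset.disjoint_singleton_left.2 hi)
    have hind := iIndepFun.indepFun_finset₀ _ _ hdisj hW hm
    have h1 : Measurable fun w : (({i} : Finset ι) ×ˢ (Finset.univ : Finset κ) : Finset _) → 𝓧 =>
        f fun k => w ⟨(i, k), by simp⟩ :=
      hf.comp (measurable_pi_lambda _ fun k => measurable_pi_apply _)
    have h2 : Measurable fun w : ((s ×ˢ (Finset.univ : Finset κ) : Finset _) → 𝓧) =>
        ∑ j ∈ s.attach, f fun k => w ⟨(j.1, k), by simp⟩ :=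
      Finset.measurable_sum _ fun j _ =>
        hf.comp (measurable_pi_lambda _ fun k => measurable_pi_apply _)
    have h3 := hind.comp h1 h2
    have hX : ∀ j, AEMeasurable (fun ω => f fun k => W (j, k) ω) P := fun j =>
      hf.comp_aemeasurable (aemeasurable_pi_lambda _ fun k => hm _)
    have e2 : ((fun w : ((s ×ˢ (Finset.univ : Finset κ) : Finset _) → 𝓧) =>
        ∑ j ∈ s.attach, f fun k => w ⟨(j.1, k), by simp⟩) ∘
        fun ω (q : (s ×ˢ (Finset.univ : Finset κ) : Finset _)) => W q ω) =
        ∑ j ∈ s, fun ω => f fun k => W (j, k) ω := by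
      ext ω
      simp only [Function.comp_apply, Finset.sum_apply]
      exact Finset.sum_attach s fun j => f fun k => W (j, k) ω
    rw [e2] at h3
    exact h3.mgf_add' (hX i).aestronglyMeasurable
      (Finset.aemeasurable_sum _ fun j _ => hX j).aestronglyMeasurable

lemma lintegral_prod_prod {α β γ δ : Type*} [MeasurableSpace α] [MeasurableSpace β]
    [MeasurableSpace γ] [MeasurableSpace δ] (μa : Measure α) (μb : Measure β) (μc : Measure γ)
    (μd : Measure δ) [SFinite μa] [SFinite μb] [SFinite μc] [SFinite μd]
    {f : (α × β) × (γ × δ) → ENNReal} (hf : Measurable f) :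
    ∫⁻ p, f p ∂(μa.prod μb).prod (μc.prod μd) =
      ∫⁻ a, ∫⁻ b, ∫⁻ c, ∫⁻ d, f ((a, b), (c, d)) ∂μd ∂μc ∂μb ∂μa := by
  rw [lintegral_prod _ hf.aemeasurable, lintegral_prod _ hf.lintegral_prod_right'.aemeasurable]
  refine lintegral_congr fun a => lintegral_congr fun b => ?_
  exact lintegral_prod _ (hf.comp measurable_prodMk_left).aemeasurable

/-- The exchange of the two middle factors preserves product measures. -/
lemma measurePreserving_prodProdProdComm {α β γ δ : Type*} [MeasurableSpace α] [MeasurableSpace β]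
    [MeasurableSpace γ] [MeasurableSpace δ] (μa : Measure α) (μb : Measure β) (μc : Measure γ)
    (μd : Measure δ) [SFinite μa] [SFinite μb] [SFinite μc] [SFinite μd] :
    MeasurePreserving (fun p : (α × β) × (γ × δ) => ((p.1.1, p.2.1), (p.1.2, p.2.2)))
      ((μa.prod μb).prod (μc.prod μd)) ((μa.prod μc).prod (μb.prod μd)) := by
  have hm : Measurable fun p : (α × β) × (γ × δ) => ((p.1.1, p.2.1), (p.1.2, p.2.2)) := by fun_prop
  refine ⟨hm, Measure.ext_of_lintegral _ fun f hf => ?_⟩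
  rw [lintegral_map hf hm, lintegral_prod_prod _ _ _ _ (by fun_prop),
    lintegral_prod_prod _ _ _ _ hf]
  refine lintegral_congr fun a => ?_
  refine lintegral_lintegral_swap (f := fun b c => ∫⁻ d, f ((a, c), (b, d)) ∂μd) ?_
  exact (Measurable.lintegral_prod_right' (f := fun q : (β × γ) × δ => f ((a, q.1.2), (q.1.1, q.2)))
    (hf.comp (by fun_prop))).aemeasurable

/-! ### Concentration in the noisy model and the union bound. -/

section Model

variable {Ω : Type*} [MeasurableSpace Ω] {P : Measure Ω} {n m : ℕ} {γ : ℝ}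
  {a : Fin m → Fin 2 → Ω → EuclideanSpace ℂ (Fin n)} {ν : Fin m → Fin 2 → Ω → ℝ}

/-- One summand of the quadratic form as a function of its block of random inputs. -/
def summand {n : ℕ} (x₀ x : EuclideanSpace ℂ (Fin n))
    (w : Fin 2 → EuclideanSpace ℂ (Fin n) × ℝ) : ℝ :=
  bit x₀ (((w 0).1, (w 1).1), ((w 0).2, (w 1).2)) * gap x ((w 0).1, (w 1).1)

lemma measurable_summand (x₀ x : EuclideanSpace ℂ (Fin n)) : Measurable (summand x₀ x) :=
  ((measurable_bit x₀).comp (by fun_prop)).mul ((measurable_gap x).comp (by fun_prop))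

lemma abs_summand_le (x₀ x : EuclideanSpace ℂ (Fin n))
    (w : Fin 2 → EuclideanSpace ℂ (Fin n) × ℝ) :
    |summand x₀ x w| ≤ ‖inner ℂ (w 0).1 x‖ ^ 2 + ‖inner ℂ (w 1).1 x‖ ^ 2 := by
  have h1 := abs_sign_le_one (‖inner ℂ (w 0).1 x₀‖ ^ 2 - ‖inner ℂ (w 1).1 x₀‖ ^ 2 +
    ((w 0).2 - (w 1).2))
  have h2 : |gap x ((w 0).1, (w 1).1)| ≤ ‖inner ℂ (w 0).1 x‖ ^ 2 + ‖inner ℂ (w 1).1 x‖ ^ 2 := by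
    unfold gap
    rw [abs_le]
    constructor <;> nlinarith [sq_nonneg ‖(inner ℂ (w 0).1 x : ℂ)‖,
      sq_nonneg ‖(inner ℂ (w 1).1 x : ℂ)‖]
  rw [summand, abs_mul]
  refine (mul_le_of_le_one_left (abs_nonneg _) h1).trans h2

lemma oneBit_eq_bit (x₀ : EuclideanSpace ℂ (Fin n)) (b : Fin 2 → EuclideanSpace ℂ (Fin n))
    (v : Fin 2 → ℝ) : oneBit x₀ b v = bit x₀ ((b 0, b 1), (v 0, v 1)) := by
  unfold oneBit noisyIntensity bit
  congr 1
  ring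

/-- The law of one block of inputs of the noisy model. -/
lemma IsNoisyModel.hasLaw_pair [IsProbabilityMeasure P] (h : IsNoisyModel P γ a ν) (hγ : 0 < γ) (i : Fin m) :
    HasLaw (fun ω => ((a i 0 ω, a i 1 ω), (ν i 0 ω, ν i 1 ω))) (pairLaw n γ) P := by
  have := isProbabilityMeasure_expMeasure hγ
  have h1 : ∀ j, HasLaw (fun ω => (a i j ω, ν i j ω))
      ((complexGaussian n).prod (expMeasure γ)) P := fun j =>
    (h.indep_within i j).hasLaw_prod (h.law_sensing i j) (h.law_noise i j)
  have h2 := (h.indep_pairs.indepFun (i := (i, 0)) (j := (i, 1)) (by simp)).hasLaw_prod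
    (h1 0) (h1 1)
  -- The model groups each vector with its own noise, while `pairLaw` groups vectors with vectors
  -- and noises with noises.
  exact (measurePreserving_prodProdProdComm (complexGaussian n) (expMeasure γ)
    (complexGaussian n) (expMeasure γ)).hasLaw.comp h2

lemma IsNoisyModel.integrable_summand [IsProbabilityMeasure P] (h : IsNoisyModel P γ a ν) (hγ : 0 < γ) (i : Fin m)
    (x₀ x : EuclideanSpace ℂ (Fin n)) :
    Integrable (fun ω => summand x₀ x fun k => (a i k ω, ν i k ω)) P := by
  have hl := h.hasLaw_pair hγ i
  have := integrable_bit_mul_gap (n := n) hγ x₀ x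
  rw [← hl.map_eq] at this
  exact this.comp_aemeasurable hl.aemeasurable

lemma IsNoisyModel.integral_summand [IsProbabilityMeasure P] (h : IsNoisyModel P γ a ν) (hγ : 0 < γ) (i : Fin m)
    {x₀ x : EuclideanSpace ℂ (Fin n)} (hx₀ : ‖x₀‖ = 1) (hx : ‖x‖ = 1) :
    ∫ ω, summand x₀ x (fun k => (a i k ω, ν i k ω)) ∂P = ‖inner ℂ x₀ x‖ ^ 2 * signal γ x₀ := by
  rw [← integral_bit_mul_gap hγ hx₀ hx]
  exact (h.hasLaw_pair hγ i).integral_comp (f := fun q => bit x₀ q * gap x q.1)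
    ((measurable_bit x₀).mul ((measurable_gap x).comp measurable_fst)).aestronglyMeasurable

lemma IsNoisyModel.integrable_exp (h : IsNoisyModel P γ a ν) (i : Fin m) (j : Fin 2)
    {x : EuclideanSpace ℂ (Fin n)} (hx : ‖x‖ = 1) :
    Integrable (fun ω => Real.exp (‖inner ℂ (a i j ω) x‖ ^ 2 / 2)) P := by
  have := integrable_exp_norm_inner hx
  rw [← (h.law_sensing i j).map_eq] at this
  exact this.comp_aemeasurable (h.law_sensing i j).aemeasurable

lemma IsNoisyModel.integral_exp (h : IsNoisyModel P γ a ν) (i : Fin m) (j : Fin 2)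
    {x : EuclideanSpace ℂ (Fin n)} (hx : ‖x‖ = 1) :
    ∫ ω, Real.exp (‖inner ℂ (a i j ω) x‖ ^ 2 / 2) ∂P = 2 := by
  exact ((h.law_sensing i j).integral_comp (f := fun b => Real.exp (‖inner ℂ b x‖ ^ 2 / 2))
    (by fun_prop)).trans (integral_exp_norm_inner hx)

lemma IsNoisyModel.mgf_sum (h : IsNoisyModel P γ a ν) (x₀ x : EuclideanSpace ℂ (Fin n)) (s : ℝ) :
    mgf (∑ i, fun ω => summand x₀ x fun k => (a i k ω, ν i k ω)) P s =
      ∏ i, mgf (fun ω => summand x₀ x fun k => (a i k ω, ν i k ω)) P s :=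
  mgf_sum_blocks h.indep_pairs (fun q => (h.law_sensing q.1 q.2).aemeasurable.prodMk
    (h.law_noise q.1 q.2).aemeasurable) (measurable_summand x₀ x) s Finset.univ

/-- The moment generating function of the sum of all summands. -/
lemma IsNoisyModel.mgf_sum_le [IsProbabilityMeasure P] (h : IsNoisyModel P γ a ν) (hγ : 0 < γ)
    {x₀ x : EuclideanSpace ℂ (Fin n)} (hx₀ : ‖x₀‖ = 1) (hx : ‖x‖ = 1) {s : ℝ} (hs : |s| ≤ 1 / 8) :
    mgf (∑ i, fun ω => summand x₀ x fun k => (a i k ω, ν i k ω)) P s ≤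
      Real.exp (m * (s * (‖inner ℂ x₀ x‖ ^ 2 * signal γ x₀) + 256 * s ^ 2)) := by
  rw [h.mgf_sum]
  calc _ ≤ ∏ _i : Fin m, Real.exp (s * (‖inner ℂ x₀ x‖ ^ 2 * signal γ x₀) + 256 * s ^ 2) := by
        refine Finset.prod_le_prod (fun i _ => mgf_nonneg) fun i _ => ?_
        have := mgf_le_of_abs_le_add (h.integrable_summand hγ i x₀ x) (h.integrable_exp i 0 hx)
          (h.integrable_exp i 1 hx) (h.integral_exp i 0 hx).le (h.integral_exp i 1 hx).le
          (fun ω => abs_summand_le x₀ x _) hs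
        rwa [h.integral_summand hγ i hx₀ hx] at this
    _ = _ := by
      rw [Finset.prod_const, Finset.card_univ, Fintype.card_fin, ← Real.exp_nat_mul]

lemma IsNoisyModel.integrable_exp_sum [IsProbabilityMeasure P] (h : IsNoisyModel P γ a ν) (hγ : 0 < γ)
    (x₀ : EuclideanSpace ℂ (Fin n)) {x : EuclideanSpace ℂ (Fin n)} (hx : ‖x‖ = 1) {s : ℝ}
    (hs : |s| ≤ 1 / 8) :
    Integrable (fun ω => Real.exp (s *
      (∑ i, fun ω => summand x₀ x fun k => (a i k ω, ν i k ω)) ω)) P := by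
  refine .of_integral_ne_zero ?_
  change mgf (∑ i, fun ω => summand x₀ x fun k => (a i k ω, ν i k ω)) P s ≠ 0
  rw [h.mgf_sum]
  exact (Finset.prod_pos fun i _ => mgf_pos (integrable_exp_mul_of_abs_le_add
    (h.integrable_summand hγ i x₀ x) (h.integrable_exp i 0 hx) (h.integrable_exp i 1 hx)
    (fun ω => abs_summand_le x₀ x _) hs)).ne'

/-- Bernstein's inequality for the deviation at a fixed unit vector. -/
lemma IsNoisyModel.measureReal_deviation_ge_le [IsProbabilityMeasure P] (h : IsNoisyModel P γ a ν) (hγ : 0 < γ)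
    {x₀ x : EuclideanSpace ℂ (Fin n)} (hx₀ : ‖x₀‖ = 1) (hx : ‖x‖ = 1) (hm : 0 < m) {τ : ℝ}
    (hτ : 0 < τ) (hτ1 : τ ≤ 64) :
    P.real {ω | τ ≤ |deviation (fun i => oneBit x₀ (fun j => a i j ω) (fun j => ν i j ω))
      (fun i j => a i j ω) (signal γ x₀) x₀ x|} ≤ 2 * Real.exp (-(m * τ ^ 2 / 1024)) := by
  set S : Ω → ℝ := ∑ i, fun ω => summand x₀ x fun k => (a i k ω, ν i k ω) with hS
  set μ := ‖inner ℂ x₀ x‖ ^ 2 * signal γ x₀ with hμ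
  have hm' : (0 : ℝ) < m := by exact_mod_cast hm
  have hdev : ∀ ω, deviation (fun i => oneBit x₀ (fun j => a i j ω) (fun j => ν i j ω))
      (fun i j => a i j ω) (signal γ x₀) x₀ x = S ω / m - μ := by
    intro ω
    rw [deviation, hS, hμ, Finset.sum_apply]
    simp_rw [oneBit_eq_bit]
    unfold summand gap
    ring
  have hsub : {ω | τ ≤ |deviation (fun i => oneBit x₀ (fun j => a i j ω) (fun j => ν i j ω))
      (fun i j => a i j ω) (signal γ x₀) x₀ x|} ⊆
      {ω | m * (μ + τ) ≤ S ω} ∪ {ω | S ω ≤ m * (μ - τ)} := by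
    intro ω hω
    rw [Set.mem_ofPred_eq, hdev] at hω
    rcases le_abs.1 hω with h1 | h1
    · left
      have : μ + τ ≤ S ω / m := by linarith
      rw [le_div_iff₀ hm'] at this
      rw [Set.mem_ofPred_eq]; linarith
    · right
      have : S ω / m ≤ μ - τ := by linarith
      rw [div_le_iff₀ hm'] at this
      rw [Set.mem_ofPred_eq]; linarith
  -- The parameter `s = τ / 512` minimizes `-s τ + 256 s²`, with value `-τ² / 1024`; it is
  -- admissible because `τ ≤ 64`.
  have hs : |τ / 512| ≤ 1 / 8 := by rw [abs_of_pos (by positivity)]; linarith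
  have hs' : |-(τ / 512)| ≤ 1 / 8 := by rwa [abs_neg]
  have up : P.real {ω | m * (μ + τ) ≤ S ω} ≤ Real.exp (-(m * τ ^ 2 / 1024)) := by
    refine (measure_ge_le_exp_mul_mgf (m * (μ + τ)) (t := τ / 512) (by positivity)
      (h.integrable_exp_sum hγ x₀ hx hs)).trans ?_
    refine (mul_le_mul_of_nonneg_left (h.mgf_sum_le hγ hx₀ hx hs) (Real.exp_pos _).le).trans ?_
    rw [← Real.exp_add]
    refine Real.exp_le_exp.2 (le_of_eq ?_)
    ring
  have dn : P.real {ω | S ω ≤ m * (μ - τ)} ≤ Real.exp (-(m * τ ^ 2 / 1024)) := by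
    refine (measure_le_le_exp_mul_mgf (m * (μ - τ)) (t := -(τ / 512))
      (by linarith) (h.integrable_exp_sum hγ x₀ hx hs')).trans ?_
    refine (mul_le_mul_of_nonneg_left (h.mgf_sum_le hγ hx₀ hx hs') (Real.exp_pos _).le).trans ?_
    rw [← Real.exp_add]
    refine Real.exp_le_exp.2 (le_of_eq ?_)
    ring
  calc _ ≤ P.real ({ω | m * (μ + τ) ≤ S ω} ∪ {ω | S ω ≤ m * (μ - τ)}) := measureReal_mono hsub
    _ ≤ _ := measureReal_union_le _ _
    _ ≤ _ := by linarith

/-- A union bound over a net: with high probability all solutions are close to `x₀`. -/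
lemma IsNoisyModel.exists_good_event [IsProbabilityMeasure P] (h : IsNoisyModel P γ a ν) (hγ : 0 < γ)
    {x₀ : EuclideanSpace ℂ (Fin n)} (hx₀ : ‖x₀‖ = 1) (hm : 0 < m) {ε : ℝ} (hε : 0 < ε)
    (hε1 : ε ≤ 1) :
    ∃ G : Set Ω, MeasurableSet G ∧
      1 - 25 ^ n * (2 * Real.exp (-(m * (signal γ x₀ * √ε / 128) ^ 2 / 1024))) ≤ P.real G ∧
      ∀ ω ∈ G, ∀ xhat : EuclideanSpace ℂ (Fin n),
        IsOneBitPhaseSolution (fun i => oneBit x₀ (fun j => a i j ω) (fun j => ν i j ω))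
          (fun i j => a i j ω) xhat →
        ∃ φ : ℝ, 0 ≤ φ ∧ φ ≤ 2 * Real.pi ∧
          ‖xhat - Complex.exp (Complex.I * φ) • x₀‖ ^ 2 ≤ ε := by
  obtain ⟨s, hs1, hscard, hsnet⟩ := exists_half_net n
  have hl : 0 < signal γ x₀ := lt_of_lt_of_le (by positivity) (signal_ge hγ hx₀)
  have hl2 := signal_le_two hγ hx₀
  have hsε : 0 < √ε := Real.sqrt_pos.2 hε
  have hsε1 : √ε ≤ 1 := Real.sqrt_le_one.2 hε1
  -- The net costs a factor `32`, so `M = 32 τ = l √ε / 4` and `16 M² / l² = ε`.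
  set τ := signal γ x₀ * √ε / 128 with hτ
  have hτ0 : 0 < τ := by positivity
  have hτ1 : τ ≤ 64 := by
    have : signal γ x₀ * √ε ≤ 2 * 1 := by gcongr
    rw [hτ]; linarith
  set D : Ω → EuclideanSpace ℂ (Fin n) → ℝ := fun ω =>
    deviation (fun i => oneBit x₀ (fun j => a i j ω) (fun j => ν i j ω))
      (fun i j => a i j ω) (signal γ x₀) x₀ with hD
  set B : Set Ω := ⋃ c ∈ s, {ω | τ ≤ |D ω c|} with hB
  have hBm : P.real B ≤ 25 ^ n * (2 * Real.exp (-(m * τ ^ 2 / 1024))) := by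
    calc P.real B ≤ ∑ c ∈ s, P.real {ω | τ ≤ |D ω c|} := measureReal_biUnion_finset_le _ _
      _ ≤ ∑ _c ∈ s, 2 * Real.exp (-(m * τ ^ 2 / 1024)) :=
        Finset.sum_le_sum fun c hc =>
          h.measureReal_deviation_ge_le hγ hx₀ (hs1 c hc) hm hτ0 hτ1
      _ ≤ _ := by
        rw [Finset.sum_const, nsmul_eq_mul]
        gcongr
        exact_mod_cast hscard
  -- The inputs are only almost everywhere measurable, so `B` is replaced by a measurable hull of
  -- the same measure.
  refine ⟨(toMeasurable P B)ᶜ, (measurableSet_toMeasurable P B).compl, ?_, ?_⟩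
  · rw [probReal_compl_eq_one_sub (measurableSet_toMeasurable P B), measureReal_def,
      measure_toMeasurable, ← measureReal_def]
    linarith
  · intro ω hω xhat hxhat
    have hωB : ω ∉ B := fun hb => hω (subset_toMeasurable P B hb)
    have hnet : ∀ c ∈ s, |D ω c| ≤ τ := by
      intro c hc
      by_contra! hlt
      exact hωB (Set.mem_biUnion hc hlt.le)
    have hq : IsHermitianForm (D ω) := isHermitianForm_deviation _ _ _ _
    have hM : ∀ z, ‖z‖ = 1 → |D ω z| ≤ 32 * τ := fun z hz => hq.abs_le_of_net hs1 hsnet hnet hz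
    obtain ⟨φ, h0, h1, h2⟩ := solution_close hl (by positivity : 0 < 32 * τ) hx₀ hM hxhat
    refine ⟨φ, h0, h1, h2.trans (le_of_eq ?_)⟩
    rw [hτ]
    field_simp
    rw [Real.sq_sqrt hε.le]
    ring

end Model

/-! ### Choice of the constants and conclusion. -/

/-- The size of the net times the tail bound is at most `2 / n²`. -/
lemma net_card_mul_exp_le {n : ℕ} (hn : 2 ≤ n) {L E : ℝ}
    (hL : Real.log n ≤ L ∨ 1 ≤ L) (hE : 6 * (n * L) ≤ E) :
    25 ^ n * (2 * Real.exp (-E)) ≤ 2 / (n : ℝ) ^ 2 := by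
  have hn2 : (2 : ℝ) ≤ n := by exact_mod_cast hn
  have hn0 : (0 : ℝ) < n := by linarith
  have hlog0 : 0 ≤ Real.log n := Real.log_nonneg (by linarith)
  have h1 : n * Real.log 25 + 2 * Real.log n ≤ E := by
    refine le_trans ?_ hE
    rcases hL with hL | hL
    -- Since `25 ≤ 2⁵ ≤ n⁵`, the net costs `5 n log n`, and `2 log n ≤ n log n` covers the factor
    -- `n⁻²`.
    · have h25 : Real.log 25 ≤ 5 * Real.log n := by
        rw [← Nat.cast_ofNat (n := 5), ← Real.log_pow]
        refine Real.log_le_log (by norm_num) ?_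
        have := pow_le_pow_left₀ (by norm_num) hn2 5
        linarith
      have h3 : (n : ℝ) * Real.log 25 ≤ n * (5 * Real.log n) := by gcongr
      have h4 : 2 * Real.log n ≤ n * Real.log n := by gcongr
      have h5 : (n : ℝ) * Real.log n ≤ n * L := by gcongr
      linarith
    -- Here the net costs at most `4n`, and `2 log n ≤ 2n`.
    · have h25 : Real.log 25 ≤ 4 := by
        rw [Real.log_le_iff_le_exp (by norm_num)]
        have h := pow_le_pow_left₀ (by norm_num) Real.exp_one_gt_d9.le 4
        rw [← Real.exp_nat_mul] at h
        norm_num at h ⊢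
        linarith
      have h3 : (n : ℝ) * Real.log 25 ≤ n * 4 := by gcongr
      have h4 := Real.log_le_self hn0.le
      have h5 : (n : ℝ) * 1 ≤ n * L := by gcongr
      linarith
  have h6 : (25 : ℝ) ^ n = Real.exp (n * Real.log 25) := by
    rw [Real.exp_nat_mul, Real.exp_log (by norm_num)]
  have h7 : (n : ℝ) ^ 2 = Real.exp (2 * Real.log n) := by
    rw [← Nat.cast_ofNat (R := ℝ) (n := 2), Real.exp_nat_mul, Real.exp_log hn0]
  rw [h6, h7, div_eq_mul_inv, ← Real.exp_neg, mul_left_comm, ← Real.exp_add]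
  gcongr
  linarith

end OneBit

end

theorem mainTheorem3 :
    ∃ C K : ℝ, 0 < C ∧ 0 < K ∧
      ∀ γ σ : ℝ, 0 < γ → σ = 1 / γ ^ 2 →
        ∃ N : ℕ, ∀ n : ℕ,
          ∀ x₀ : EuclideanSpace ℂ (Fin n), ‖x₀‖ = 1 →
          ∀ ε : ℝ, 0 < ε → ε ≤ 1 →
          (N ≤ n ∨ ε ≤ (1 + 2 * √σ) / (1 + √σ) ^ 2) →
          ∀ m : ℕ,
            C / ε ^ 2 * ((1 + √σ) ^ 2 / (1 + 2 * √σ)) * ((n : ℝ) * Real.log n) ≤ (m : ℝ) →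
          ∀ (Ω : Type*) [MeasurableSpace Ω] (P : Measure Ω) [IsProbabilityMeasure P]
            (a : Fin m → Fin 2 → Ω → EuclideanSpace ℂ (Fin n)) (ν : Fin m → Fin 2 → Ω → ℝ),
            OneBit.IsNoisyModel P γ a ν →
            ∃ G : Set Ω, MeasurableSet G ∧ 1 - K / (n : ℝ) ^ 2 ≤ P.real G ∧
              ∀ ω ∈ G, ∀ xhat : EuclideanSpace ℂ (Fin n),
                OneBit.IsOneBitPhaseSolution
                  (fun i => OneBit.oneBit x₀ (fun j => a i j ω) (fun j => ν i j ω))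
                  (fun i j => a i j ω) xhat →
                ∃ φ : ℝ, 0 ≤ φ ∧ φ ≤ 2 * Real.pi ∧
                  ‖xhat - Complex.exp (Complex.I * φ) • x₀‖ ^ 2 ≤ ε := by
  -- The `6` is that of `net_card_mul_exp_le`, `400 = 20²` comes from `l / 20 ≤ signal`, `128` from
  -- the threshold `τ`, and `1024` from the tail bound.
  refine ⟨6 * (400 * 128 ^ 2 * 1024), 2, by norm_num, by norm_num, fun γ σ hγ hσ => ?_⟩
  have hs : √σ = 1 / γ := by
    rw [hσ, Real.sqrt_div zero_le_one, Real.sqrt_one, Real.sqrt_sq hγ.le]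
  rw [hs]
  set s := 1 / γ with hsdef
  have hs0 : 0 < s := by positivity
  set l := (1 + 2 * s) / (1 + s) ^ 2 with hldef
  have hl0 : 0 < l := by positivity
  -- For `n` above this value, `l log n ≥ 1`. From here on `l` denotes the explicit ratio in `s =
  -- √σ`, not the signal strength.
  refine ⟨⌈Real.exp (1 / l)⌉₊, fun n x₀ hx₀ ε hε hε1 hcase m hm Ω _ P _ a ν hmodel => ?_⟩
  -- There is no unit vector for `n = 0`, and for `n = 1` the claimed probability `1 - 2` is
  -- negative, so the empty event serves.
  rcases Nat.lt_or_ge n 2 with hn | hn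
  · refine ⟨∅, MeasurableSet.empty, ?_, by simp⟩
    rw [measureReal_empty]
    interval_cases n
    · have : x₀ = 0 := Subsingleton.elim _ _
      simp [this] at hx₀
    · norm_num
  have hn2 : (2 : ℝ) ≤ n := by exact_mod_cast hn
  have hlog : 0 < Real.log n := Real.log_pos (by linarith)
  have hinv : (1 + s) ^ 2 / (1 + 2 * s) = 1 / l := by rw [hldef, one_div_div]
  rw [hinv] at hm
  have hm0 : 0 < m := by
    have : (0 : ℝ) < m := lt_of_lt_of_le (by positivity) hm
    exact_mod_cast this
  obtain ⟨G, hG, hPG, hsol⟩ := hmodel.exists_good_event hγ hx₀ hm0 hε hε1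
  refine ⟨G, hG, le_trans ?_ hPG, hsol⟩
  refine sub_le_sub_left (OneBit.net_card_mul_exp_le hn (L := l * Real.log n / ε) ?_ ?_) 1
  · rcases hcase with hN | hle
    · right
      have h1 : Real.exp (1 / l) ≤ n := (Nat.le_ceil _).trans (by exact_mod_cast hN)
      have h2 : 1 / l ≤ Real.log n := by
        rwa [Real.le_log_iff_exp_le (by linarith)]
      rw [div_le_iff₀ hl0] at h2
      rw [le_div_iff₀ hε]
      linarith
    · left
      rw [le_div_iff₀ hε, mul_comm]
      gcongr
  -- After clearing denominators this is `1 + 2s ≤ 2 (1 + s)`.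
  · have hsig : l / 20 ≤ OneBit.signal γ x₀ := by
      refine le_trans ?_ (OneBit.signal_ge hγ hx₀)
      rw [← hsdef, hldef, div_div, div_le_div_iff₀ (by positivity) (by positivity)]
      nlinarith
    calc 6 * (n * (l * Real.log n / ε)) =
        6 * (400 * 128 ^ 2 * 1024) / ε ^ 2 * (1 / l) * (n * Real.log n) *
          (l / 20 * √ε / 128) ^ 2 / 1024 := by
          rw [div_pow, mul_pow, Real.sq_sqrt hε.le]
          field_simp
          norm_num
      _ ≤ _ := by gcongr
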